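/- Throughout, $\mathbb{S}^1=\mathbb{R}/\mathbb{Z}$, $d\ge 1$, $\mathbb{T}^d=(\mathbb{R}/\mathbb{Z})^d$, $\mathbb{A}^d=\mathbb{T}^{d-1}\times\mathbb{R}$, and $\pi:\mathbb{A}^d\to\mathbb{T}^d$ is the quotient map. A continuum is a non-empty compact connected set. *Annulus.* A continuum $E\subset\mathbb{A}^d$ is essential if $\mathbb{A}^d\setminus E$ has two different unbounded connected components; the one unbounded above is $\mathcal{U}^+(E)$, the one unbounded below is $\mathcal{U}^-(E)$. It is an essential annular continuum if moreover $\mathbb{A}^d\setminus E=\mathcal{U}^+(E)\cup\mathcal{U}^-(E)$, and an essential circloid if it is an essential annular continuum that contains no other essential annular continuum. *Torus.* For a linear automorphism $L$ of $\mathbb{T}^d$ (an element of $\mathrm{GL}(d,\mathbb{Z})$), a lift of $A\subset\mathbb{T}^d$ with respect to $L$ is a connected component of $(L\circ\pi)^{-1}(A)\subset\mathbb{A}^d$. A continuum in $\mathbb{T}^d$ is essential (respectively an essential annular continuum, an essential circloid) if, for some $L$, it has a lift that is an essential continuum (respectively an essential annular continuum, an essential circloid) in $\mathbb{A}^d$.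 *Circular order.* Fix $L$. Two lifts $\hat A_1,\hat A_3$ with $\hat A_3\subset\mathcal{U}^+(\hat A_1)$ are adjacent if $\mathbb{A}^d\setminus(\mathcal{U}^-(\hat A_1)\cup\mathcal{U}^+(\hat A_3))$ contains no non-trivial integer translate (in the last coordinate) of $\hat A_1$ or $\hat A_3$. Write $A_1\prec A_2\prec A_3$ if $A_2\subset (L\circ\pi)\bigl(\mathcal{U}^+(\hat A_1)\cap\mathcal{U}^-(\hat A_3)\bigr)$ for adjacent lifts $\hat A_1,\hat A_3$ of $A_1,A_3$. A sequence $(A_k)_{k\in\mathbb{Z}}$ of pairwise disjoint continua in $\mathbb{T}^d$, essential with respect to a common $L$, has irrational combinatorics if there is $\rho\in\mathbb{R}\setminus\mathbb{Q}$ such that for every $y_0\in\mathbb{S}^1$, with $y_k=y_0+k\rho \bmod 1$, one has $A_k\prec A_m\prec A_l$ if and only if $y_k<y_m<y_l$ in the strict circular order of $\mathbb{S}^1$, for all $k,m,l\in\mathbb{Z}$. *Dynamics.* Let $f:\mathbb{T}^d\to\mathbb{T}^d$ be a homeomorphism. A set $A$ is wandering if $f^k(A)\cap A=\emptyset$ for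 all $k\ge1$; a wandering essential continuum $E$ has irrational combinatorics if the sequence $(f^k(E))_{k\in\mathbb{Z}}$ does. A semiconjugacy from $f$ to the rotation $R_\rho(\xi)=\xi+\rho$ of $\mathbb{S}^1$ is a continuous surjection $h:\mathbb{T}^d\to\mathbb{S}^1$ with $h\circ f=R_\rho\circ h$; the rotation is irrational if $\rho\notin\mathbb{Q}$. **Theorem.** Let $f$ be a homeomorphism of $\mathbb{T}^d$ homotopic to the identity. The following are equivalent: (i) there is a semiconjugacy from $f$ to some irrational rotation of the circle; (ii) there exists a wandering essential circloid with irrational combinatorics; (iii) there exists a wandering essential continuum with irrational combinatorics; (iv) there is a semiconjugacy $h$ from $f$ to some irrational rotation of the circle such that for every $\xi\in\mathbb{S}^1$ the fibre $h^{-1}\{\xi\}$ is an essential annular continuum. -/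

import Mathlib

/-- The `d`-dimensional torus `𝕋^d = (ℝ/ℤ)^d`. -/
abbrev Torus (d : ℕ) : Type := Fin d → UnitAddCircle

/-- The annulus `𝔸^(n+1) = 𝕋^n × ℝ`, of dimension `n + 1`. -/
abbrev Annulus (n : ℕ) : Type := Torus n × ℝ

namespace Annulus

variable {n : ℕ}

/-- The canonical quotient map `𝔸^(n+1) → 𝕋^(n+1)`, reducing the last coordinate mod `1`. -/
def proj (z : Annulus n) : Torus (n + 1) :=
  Fin.snoc (α := fun _ => UnitAddCircle) z.1 (z.2 : UnitAddCircle)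

/-- The integer translation `(x, t) ↦ (x, t + j)`. -/
def shift (j : ℤ) (z : Annulus n) : Annulus n := (z.1, z.2 + j)

/-- `𝒰⁺(B)`: the part of the complement of `B` formed by the connected components that are
unbounded above. If `B` is bounded above there is exactly one such component. -/
def upper (B : Set (Annulus n)) : Set (Annulus n) :=
  {z | z ∈ Bᶜ ∧ ¬ BddAbove (Prod.snd '' connectedComponentIn Bᶜ z)}

/-- `𝒰⁻(B)`: the part of the complement of `B` formed by the connected components that are
unbounded below. If `B` is bounded below there is exactly one such component. -/
def lower (B : Set (Annulus n)) : Set (Annulus n) :=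
  {z | z ∈ Bᶜ ∧ ¬ BddBelow (Prod.snd '' connectedComponentIn Bᶜ z)}

/-- An essential continuum in the annulus: a continuum whose complement has two different
unbounded connected components. -/
def IsEssentialContinuum (E : Set (Annulus n)) : Prop :=
  IsCompact E ∧ IsConnected E ∧
    ∃ z ∈ Eᶜ, ∃ w ∈ Eᶜ,
      connectedComponentIn Eᶜ z ≠ connectedComponentIn Eᶜ w ∧
      ¬ Bornology.IsBounded (connectedComponentIn Eᶜ z) ∧
      ¬ Bornology.IsBounded (connectedComponentIn Eᶜ w)

/-- An essential annular continuum in the annulus: an essential continuum whose complement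
consists of the two unbounded components only. -/
def IsEssentialAnnularContinuum (A : Set (Annulus n)) : Prop :=
  IsEssentialContinuum A ∧ Aᶜ = upper A ∪ lower A

/-- An essential circloid in the annulus: an essential annular continuum that contains no other
essential annular continuum. -/
def IsEssentialCircloid (C : Set (Annulus n)) : Prop :=
  IsEssentialAnnularContinuum C ∧
    ∀ B : Set (Annulus n), B ⊆ C → IsEssentialAnnularContinuum B → B = C

/-- The order `A₁ ≼ A₂` of continua in the annulus: `A₂` lies above `A₁`. -/
def Precedes (A₁ A₂ : Set (Annulus n)) : Prop := A₂ ⊆ upper A₁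

/-- The closed interval `[A₁, A₂]` in the annulus. -/
def closedInterval (A₁ A₂ : Set (Annulus n)) : Set (Annulus n) := (lower A₁ ∪ upper A₂)ᶜ

/-- The open interval `(A₁, A₂)` in the annulus. -/
def openInterval (A₁ A₂ : Set (Annulus n)) : Set (Annulus n) := upper A₁ ∩ lower A₂

/-- `A₁ ≼ A₂` are adjacent: the closed interval between them contains no (nontrivial) integer
translate of `A₁` or of `A₂`. -/
def Adjacent (A₁ A₂ : Set (Annulus n)) : Prop :=
  Precedes A₁ A₂ ∧
    ∀ j : ℤ, j ≠ 0 →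
      ¬ (shift j '' A₁ ⊆ closedInterval A₁ A₂) ∧ ¬ (shift j '' A₂ ⊆ closedInterval A₁ A₂)

end Annulus

namespace Torus

variable {n : ℕ}

/-- The covering `𝔸^(n+1) → 𝕋^(n+1)` given by the canonical quotient map followed by a linear
automorphism `L` of the torus. (The continuous group automorphisms of `𝕋^d` are exactly those
induced by matrices in `GL(d, ℤ)`.) Taking `L` to be the identity gives the horizontal homotopy
type; the other `L` give the other homotopy types. -/
def cover (L : Torus (n + 1) ≃ₜ+ Torus (n + 1)) (z : Annulus n) : Torus (n + 1) :=
  L (Annulus.proj z)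

/-- `A'` is a lift of `A`: a connected component of the preimage of `A` in the annulus. -/
def IsLift (L : Torus (n + 1) ≃ₜ+ Torus (n + 1)) (A : Set (Torus (n + 1)))
    (A' : Set (Annulus n)) : Prop :=
  ∃ z ∈ cover L ⁻¹' A, A' = connectedComponentIn (cover L ⁻¹' A) z

/-- An essential continuum in the torus: a continuum that lifts to an essential continuum in the
annulus. -/
def IsEssentialContinuum (E : Set (Torus (n + 1))) : Prop :=
  IsCompact E ∧ IsConnected E ∧
    ∃ (L : Torus (n + 1) ≃ₜ+ Torus (n + 1)) (E' : Set (Annulus n)),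
      IsLift L E E' ∧ Annulus.IsEssentialContinuum E'

/-- An essential annular continuum in the torus: a continuum that lifts to an essential annular
continuum in the annulus. -/
def IsEssentialAnnularContinuum (A : Set (Torus (n + 1))) : Prop :=
  IsCompact A ∧ IsConnected A ∧
    ∃ (L : Torus (n + 1) ≃ₜ+ Torus (n + 1)) (A' : Set (Annulus n)),
      IsLift L A A' ∧ Annulus.IsEssentialAnnularContinuum A'

/-- An essential circloid in the torus: a continuum that lifts to an essential circloid in the
annulus. -/
def IsEssentialCircloid (C : Set (Torus (n + 1))) : Prop :=
  IsCompact C ∧ IsConnected C ∧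
    ∃ (L : Torus (n + 1) ≃ₜ+ Torus (n + 1)) (C' : Set (Annulus n)),
      IsLift L C C' ∧ Annulus.IsEssentialCircloid C'

/-- The strict circular order `A₁ ≺ A₂ ≺ A₃`: `A₂` lies in the open interval `(A₁, A₃)` of the
torus, the image of the open interval between adjacent lifts of `A₁` and `A₃`. -/
def StrictlyBetween (L : Torus (n + 1) ≃ₜ+ Torus (n + 1)) (A₁ A₂ A₃ : Set (Torus (n + 1))) :
    Prop :=
  ∃ A₁' A₃' : Set (Annulus n), IsLift L A₁ A₁' ∧ IsLift L A₃ A₃' ∧ Annulus.Adjacent A₁' A₃' ∧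
    A₂ ⊆ cover L '' Annulus.openInterval A₁' A₃'

/-- A sequence `(A_k)`, `k ∈ ℤ`, of pairwise disjoint essential continua (of a common homotopy
type) has irrational combinatorics: it is circularly ordered as `y_k = y₀ + k ρ mod 1` for some
irrational `ρ`. Here `sbtw` is the strict circular order of `ℝ/ℤ`. -/
def HasIrrationalCombinatorics (A : ℤ → Set (Torus (n + 1))) : Prop :=
  (∀ k m : ℤ, k ≠ m → Disjoint (A k) (A m)) ∧
  ∃ L : Torus (n + 1) ≃ₜ+ Torus (n + 1),
    (∀ k : ℤ, IsCompact (A k) ∧ IsConnected (A k) ∧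
      ∃ A' : Set (Annulus n), IsLift L (A k) A' ∧ Annulus.IsEssentialContinuum A') ∧
    ∃ ρ : ℝ, Irrational ρ ∧ ∀ (y₀ : UnitAddCircle) (k m l : ℤ),
      StrictlyBetween L (A k) (A m) (A l) ↔
        sbtw (y₀ + ((k * ρ : ℝ) : UnitAddCircle)) (y₀ + ((m * ρ : ℝ) : UnitAddCircle))
          (y₀ + ((l * ρ : ℝ) : UnitAddCircle))

/-- `A` is wandering for `f`: `f^k(A) ∩ A = ∅` for all `k ≥ 1`. -/
def IsWandering {d : ℕ} (f : Torus d ≃ₜ Torus d) (A : Set (Torus d)) : Prop :=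
  ∀ k : ℕ, 1 ≤ k → (f^[k] '' A) ∩ A = ∅

/-- `h` is a semiconjugacy from `f` to the rotation `R_ρ : ξ ↦ ξ + ρ` of the circle `ℝ/ℤ`. -/
def IsSemiconjugacy {d : ℕ} (f : Torus d ≃ₜ Torus d) (ρ : ℝ) (h : Torus d → UnitAddCircle) :
    Prop :=
  Continuous h ∧ Function.Surjective h ∧ ∀ z, h (f z) = h z + (ρ : UnitAddCircle)

end Torus

/-!
Everything is reduced to *equivariant height functions*. Lift `f` to a homeomorphism `F` of the
annulus that commutes with the integer translations. An equivariant height function is a continuous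
`H` on the annulus with `H ∘ F = H + ρ` and `H (x, t + 1) = H (x, t) + 1`, all of whose strict
sublevel and superlevel sets are connected. It induces a semiconjugacy from `f` to the rotation by
`ρ`. The fibres are the images of the levels `{H = s}`, and these are essential annular continua:
their complement consists of the connected sets `{H < s}` and `{s < H}`, and they are connected by
a form of unicoherence (`Annulus.isPreconnected_between`) that holds because a map from the annulus
to the circle that is constant near the ends lifts to the line. A circloid `C` inside one level
exists by Zorn's lemma. The lifts of the iterates of its image lie in the levels `s + kρ + j` and
are ordered like these numbers, which gives irrational combinatorics
(`Torus.hasIrrationalCombinatorics_image_cover`).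

Equivariant height functions arise from nested families of open sets `W i` that are indexed by a
dense set of values and are connected together with their complements: `H z` is the infimum of the
values of the sets that contain `z` (`heightFunction`).

* Given a semiconjugacy `h` to an irrational rotation, `h` is not null-homotopic, so that after an
  automorphism `L` of the torus it is homotopic to a nonzero multiple `m` of the last coordinate.
  Dividing a lift of `h ∘ cover L` by `m` gives an equivariant function on the annulus, and `W s`
  is the region below the upper component of its superlevel set `{s < H}`
  (`Torus.exists_isEquivariantHeight_of_isSemiconjugacy`).
* Given a wandering essential continuum with irrational combinatorics, its lifts and those of its
  iterates are totally ordered, and this order is a translation-invariant order on `ℤ × ℤ`. It has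
  a slope `ρ`, which is irrational since otherwise infinitely many iterates would be circularly
  ordered like the integers. The sets `W (k, j)` are the regions below the lifts, with the values
  `kρ + j` (`Torus.exists_isEquivariantHeight_of_hasIrrationalCombinatorics`).
-/

open Set Topology

/-! ### Connected sets and complementary components -/

section Connected

variable {α : Type*} [TopologicalSpace α]

theorem closure_connectedComponentIn_compl_subset [LocallyConnectedSpace α] {A : Set α}
    (hA : IsClosed A) (x : α) :
    closure (connectedComponentIn Aᶜ x) ⊆ connectedComponentIn Aᶜ x ∪ A := by
  intro p hp
  by_cases hpA : p ∈ A
  · exact Or.inr hpA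
  · left
    have hop : IsOpen (connectedComponentIn Aᶜ p) := hA.isOpen_compl.connectedComponentIn
    obtain ⟨q, hq, hqx⟩ := mem_closure_iff.1 hp _ hop (mem_connectedComponentIn hpA)
    rw [connectedComponentIn_eq hqx, ← connectedComponentIn_eq hq]
    exact mem_connectedComponentIn hpA

/-- The closure of a complementary component of `A` meets `A`, because a component with closure
disjoint from `A` would be open and closed. -/
theorem isPreconnected_connectedComponentIn_compl_union [LocallyConnectedSpace α]
    [PreconnectedSpace α] {A : Set α} (hc : IsPreconnected A) (hA : IsClosed A)
    (hne : A.Nonempty) (x : α) : IsPreconnected (connectedComponentIn Aᶜ x ∪ A) := by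
  rcases (connectedComponentIn Aᶜ x).eq_empty_or_nonempty with h0 | h0
  · rwa [h0, empty_union]
  have hcl := closure_connectedComponentIn_compl_subset hA x
  have hmeet : (closure (connectedComponentIn Aᶜ x) ∩ A).Nonempty := by
    by_contra hno
    rw [not_nonempty_iff_eq_empty, ← disjoint_iff_inter_eq_empty] at hno
    have hclosed : IsClosed (connectedComponentIn Aᶜ x) :=
      isClosed_of_closure_subset fun p hp => (hcl hp).resolve_right (hno.notMem_of_mem_left hp)
    have huniv := IsClopen.eq_univ ⟨hclosed, hA.isOpen_compl.connectedComponentIn⟩ h0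
    obtain ⟨a, ha⟩ := hne
    exact connectedComponentIn_subset Aᶜ x (huniv ▸ mem_univ a) ha
  have := (isPreconnected_connectedComponentIn (F := Aᶜ) (x := x)).closure.union' hmeet hc
  convert this using 1
  apply Subset.antisymm (union_subset_union_left _ subset_closure)
  exact union_subset hcl subset_union_right

/-- The complement of a component of the complement of a connected closed set is connected. -/
theorem isPreconnected_compl_connectedComponentIn_compl [LocallyConnectedSpace α]
    [PreconnectedSpace α] {A : Set α} (hc : IsPreconnected A) (hA : IsClosed A)
    (hne : A.Nonempty) (x : α) : IsPreconnected (connectedComponentIn Aᶜ x)ᶜ := by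
  obtain ⟨a, ha⟩ := hne
  have hAsub : A ⊆ (connectedComponentIn Aᶜ x)ᶜ := fun b hb hbx =>
    connectedComponentIn_subset Aᶜ x hbx hb
  refine isPreconnected_of_forall a fun y hy => ?_
  by_cases hyA : y ∈ A
  · exact ⟨A, hAsub, ha, hyA, hc⟩
  · refine ⟨connectedComponentIn Aᶜ y ∪ A, union_subset (fun p hp hpx => ?_) hAsub, Or.inr ha,
      Or.inl (mem_connectedComponentIn hyA), 
      isPreconnected_connectedComponentIn_compl_union hc hA ⟨a, ha⟩ y⟩
    apply hy
    rw [connectedComponentIn_eq hpx, ← connectedComponentIn_eq hp]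
    exact mem_connectedComponentIn hyA

/-- A separation of the intersection would, by compactness, separate one of the sets. -/
theorem IsPreconnected.iInter_of_directed [T2Space α] {ι : Type*} [Nonempty ι] {K : ι → Set α}
    (hd : Directed (· ⊇ ·) K) (hK : ∀ i, IsCompact (K i)) (hc : ∀ i, IsPreconnected (K i)) :
    IsPreconnected (⋂ i, K i) := by
  have hcomp : IsCompact (⋂ i, K i) := by
    obtain ⟨i⟩ := ‹Nonempty ι›
    exact (hK i).of_isClosed_subset (isClosed_iInter fun i => (hK i).isClosed)
      (iInter_subset _ i)
  rw [isPreconnected_iff_subset_of_fully_disjoint_closed hcomp.isClosed]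
  intro u v hu hv huv hdis
  obtain ⟨O₁, O₂, ho₁, ho₂, h₁, h₂, hO⟩ := SeparatedNhds.of_isCompact_isCompact
    (hcomp.inter_right hu) (hcomp.inter_right hv)
    (hdis.mono inter_subset_right inter_subset_right)
  obtain ⟨i, hi⟩ := exists_subset_nhds_of_isCompact' hd hK (fun i => (hK i).isClosed)
    (U := O₁ ∪ O₂) (fun x hx => (ho₁.union ho₂).mem_nhds ((huv hx).imp
      (fun h => h₁ ⟨hx, h⟩) (fun h => h₂ ⟨hx, h⟩)))
  rcases (hc i).subset_or_subset ho₁ ho₂ hO hi with h | h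
  · exact Or.inl fun x hx => (huv hx).resolve_right fun hxv =>
      hO.notMem_of_mem_left (h (mem_iInter.1 hx i)) (h₂ ⟨hx, hxv⟩)
  · exact Or.inr fun x hx => (huv hx).resolve_left fun hxu =>
      hO.notMem_of_mem_left (h₁ ⟨hx, hxu⟩) (h (mem_iInter.1 hx i))

end Connected

/-! ### The ends of the annulus -/

instance : LocallyConnectedSpace UnitAddCircle :=
  (isQuotientMap_quotient_mk' (X := ℝ)).isCoinducing.locallyConnectedSpace

namespace Annulus

variable {n : ℕ}

theorem isPreconnected_setOf_lt_snd (M : ℝ) : IsPreconnected {z : Annulus n | M < z.2} := by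
  have : {z : Annulus n | M < z.2} = univ ×ˢ Ioi M := by ext; simp
  rw [this]
  exact isPreconnected_univ.prod isPreconnected_Ioi

/-- The reflection `(x, t) ↦ (x, -t)`, which exchanges the two ends of the annulus. -/
def reflect : Annulus n ≃ₜ Annulus n := (Homeomorph.refl _).prodCongr (Homeomorph.neg ℝ)

@[simp] theorem reflect_snd (z : Annulus n) : (reflect z).2 = -z.2 := rfl

@[simp] theorem reflect_reflect (z : Annulus n) : reflect (reflect z) = z := by
  ext <;> simp [reflect]

theorem reflect_preimage_preimage (B : Set (Annulus n)) :
    reflect ⁻¹' (reflect ⁻¹' B) = B := by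
  ext; simp

theorem image_reflect (B : Set (Annulus n)) : reflect '' B = reflect ⁻¹' B :=
  congrFun (image_eq_preimage_of_inverse reflect_reflect reflect_reflect) B

theorem lower_eq_reflect (B : Set (Annulus n)) :
    lower B = reflect ⁻¹' upper (reflect ⁻¹' B) := by
  ext z
  have hmem : z ∈ Bᶜ ↔ reflect z ∈ (reflect ⁻¹' B)ᶜ := by simp
  simp only [lower, upper, mem_ofPred_eq, mem_preimage, ← hmem]
  refine and_congr_right fun hz => not_congr ?_
  rw [← preimage_compl, ← image_reflect, ← Homeomorph.image_connectedComponentIn _ hz, image_image]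
  simp only [reflect_snd]
  rw [← image_image (fun t : ℝ => -t) Prod.snd, image_neg_eq_neg, bddAbove_neg]

theorem bddAbove_reflect {B : Set (Annulus n)} :
    BddAbove (Prod.snd '' (reflect ⁻¹' B)) ↔ BddBelow (Prod.snd '' B) := by
  rw [← image_reflect, image_image]
  simp only [reflect_snd]
  rw [← image_image (fun t : ℝ => -t) Prod.snd, image_neg_eq_neg, bddAbove_neg]

section Upper

variable {B C : Set (Annulus n)}

theorem upper_subset_compl : upper B ⊆ Bᶜ := fun _ hz => hz.1

/-- A set that is bounded above has only one complementary component that is unbounded above,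
namely the one that contains the upper end of the annulus. -/
theorem upper_eq_connectedComponentIn {M : ℝ} (hB : ∀ z ∈ B, z.2 ≤ M) {w : Annulus n}
    (hw : M < w.2) : upper B = connectedComponentIn Bᶜ w := by
  have hend : {z : Annulus n | M < z.2} ⊆ Bᶜ := fun z hz hzB => (hB z hzB).not_gt hz
  have hsub : {z : Annulus n | M < z.2} ⊆ connectedComponentIn Bᶜ w :=
    (isPreconnected_setOf_lt_snd M).subset_connectedComponentIn hw hend
  ext z
  constructor
  · rintro ⟨hz, hunb⟩
    rw [not_bddAbove_iff] at hunb
    obtain ⟨_, ⟨v, hv, rfl⟩, hMv⟩ := hunb M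
    rw [connectedComponentIn_eq (hsub hMv), ← connectedComponentIn_eq hv]
    exact mem_connectedComponentIn hz
  · intro hz
    refine ⟨connectedComponentIn_subset _ _ hz, ?_⟩
    rw [← connectedComponentIn_eq hz, not_bddAbove_iff]
    intro x
    refine ⟨max x M + 1, ⟨(w.1, max x M + 1), hsub ?_, rfl⟩, ?_⟩
    · exact (le_max_right x M).trans_lt (lt_add_one _)
    · exact (le_max_left x M).trans_lt (lt_add_one _)

theorem exists_upper_eq (hB : BddAbove (Prod.snd '' B)) :
    ∃ w : Annulus n, upper B = connectedComponentIn Bᶜ w := by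
  obtain ⟨M, hM⟩ := hB
  exact ⟨(0, M + 1), upper_eq_connectedComponentIn (fun z hz => hM ⟨z, hz, rfl⟩) (lt_add_one M)⟩

theorem mem_upper_of_lt {M : ℝ} (hB : ∀ z ∈ B, z.2 ≤ M) {z : Annulus n} (hz : M < z.2) :
    z ∈ upper B := by
  rw [upper_eq_connectedComponentIn hB hz]
  exact mem_connectedComponentIn fun hzB => (hB z hzB).not_gt hz

theorem upper_nonempty (hB : BddAbove (Prod.snd '' B)) : (upper B).Nonempty := by
  obtain ⟨M, hM⟩ := hB
  exact ⟨(0, M + 1), mem_upper_of_lt (fun z hz => hM ⟨z, hz, rfl⟩) (lt_add_one M)⟩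

theorem not_bddAbove_upper (hB : BddAbove (Prod.snd '' B)) :
    ¬ BddAbove (Prod.snd '' upper B) := by
  obtain ⟨w, hw⟩ := exists_upper_eq hB
  obtain ⟨z, hz⟩ := upper_nonempty hB
  have := hz.2
  rwa [← connectedComponentIn_eq (hw ▸ hz), ← hw] at this

theorem isPreconnected_upper (hB : BddAbove (Prod.snd '' B)) : IsPreconnected (upper B) := by
  obtain ⟨w, hw⟩ := exists_upper_eq hB
  exact hw ▸ isPreconnected_connectedComponentIn

theorem isOpen_upper (hB : IsClosed B) : IsOpen (upper B) := by
  rw [isOpen_iff_mem_nhds]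
  intro z hz
  refine Filter.mem_of_superset
    (hB.isOpen_compl.connectedComponentIn.mem_nhds (mem_connectedComponentIn hz.1)) fun w hw => ?_
  refine ⟨connectedComponentIn_subset _ _ hw, ?_⟩
  rw [← connectedComponentIn_eq hw]
  exact hz.2

theorem _root_.IsPreconnected.subset_upper (hC : IsPreconnected C) (hCB : C ⊆ Bᶜ)
    (hmeet : (C ∩ upper B).Nonempty) : C ⊆ upper B := by
  obtain ⟨w, hwC, hw⟩ := hmeet
  intro z hz
  have := hC.subset_connectedComponentIn hwC hCB hz
  refine ⟨hCB hz, ?_⟩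
  rw [← connectedComponentIn_eq this]
  exact hw.2

theorem _root_.IsPreconnected.subset_upper_of_not_bddAbove (hC : IsPreconnected C)
    (hCB : C ⊆ Bᶜ) (hunb : ¬ BddAbove (Prod.snd '' C)) : C ⊆ upper B := by
  intro z hz
  refine ⟨hCB hz, fun hb => hunb (hb.mono (image_mono ?_))⟩
  exact hC.subset_connectedComponentIn hz hCB

theorem upper_anti (h : B ⊆ C) : upper C ⊆ upper B := fun _ hz =>
  ⟨fun hzB => hz.1 (h hzB), fun hb => hz.2
    (hb.mono (image_mono (connectedComponentIn_mono _ (compl_subset_compl.2 h))))⟩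

theorem closure_upper_subset (hB : IsClosed B) (hb : BddAbove (Prod.snd '' B)) :
    closure (upper B) ⊆ upper B ∪ B := by
  obtain ⟨w, hw⟩ := exists_upper_eq hb
  exact hw ▸ closure_connectedComponentIn_compl_subset hB w

theorem isPreconnected_upper_union (hB : IsClosed B) (hb : BddAbove (Prod.snd '' B))
    (hc : IsConnected B) : IsPreconnected (upper B ∪ B) := by
  obtain ⟨w, hw⟩ := exists_upper_eq hb
  exact hw ▸ isPreconnected_connectedComponentIn_compl_union hc.2 hB hc.1 w

theorem isPreconnected_compl_upper (hB : IsClosed B) (hb : BddAbove (Prod.snd '' B))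
    (hc : IsConnected B) : IsPreconnected (upper B)ᶜ := by
  obtain ⟨w, hw⟩ := exists_upper_eq hb
  exact hw ▸ isPreconnected_compl_connectedComponentIn_compl hc.2 hB hc.1 w

end Upper

section Lower

variable {B C : Set (Annulus n)}

theorem lower_subset_compl : lower B ⊆ Bᶜ := fun _ hz => hz.1

theorem mem_lower_of_lt {M : ℝ} (hB : ∀ z ∈ B, M ≤ z.2) {z : Annulus n} (hz : z.2 < M) :
    z ∈ lower B := by
  rw [lower_eq_reflect]
  refine mem_upper_of_lt (M := -M) (fun w hw => ?_) (by simpa using hz)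
  have := hB _ hw
  simp only [reflect_snd] at this
  linarith

theorem lower_nonempty (hB : BddBelow (Prod.snd '' B)) : (lower B).Nonempty := by
  rw [lower_eq_reflect, reflect.surjective.nonempty_preimage]
  exact upper_nonempty (bddAbove_reflect.2 hB)

theorem not_bddBelow_lower (hB : BddBelow (Prod.snd '' B)) :
    ¬ BddBelow (Prod.snd '' lower B) := by
  rw [← bddAbove_reflect, lower_eq_reflect, reflect_preimage_preimage]
  exact not_bddAbove_upper (bddAbove_reflect.2 hB)

theorem isPreconnected_lower (hB : BddBelow (Prod.snd '' B)) : IsPreconnected (lower B) := by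
  rw [lower_eq_reflect, ← image_reflect]
  exact (isPreconnected_upper (bddAbove_reflect.2 hB)).image _ reflect.continuous.continuousOn

theorem isOpen_lower (hB : IsClosed B) : IsOpen (lower B) := by
  rw [lower_eq_reflect]
  exact (isOpen_upper (hB.preimage reflect.continuous)).preimage reflect.continuous

theorem _root_.IsPreconnected.subset_lower (hC : IsPreconnected C) (hCB : C ⊆ Bᶜ)
    (hmeet : (C ∩ lower B).Nonempty) : C ⊆ lower B := by
  obtain ⟨w, hwC, hw⟩ := hmeet
  intro z hz
  have := hC.subset_connectedComponentIn hwC hCB hz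
  refine ⟨hCB hz, ?_⟩
  rw [← connectedComponentIn_eq this]
  exact hw.2

theorem _root_.IsPreconnected.subset_lower_of_not_bddBelow (hC : IsPreconnected C)
    (hCB : C ⊆ Bᶜ) (hunb : ¬ BddBelow (Prod.snd '' C)) : C ⊆ lower B := by
  intro z hz
  refine ⟨hCB hz, fun hb => hunb (hb.mono (image_mono ?_))⟩
  exact hC.subset_connectedComponentIn hz hCB

theorem lower_anti (h : B ⊆ C) : lower C ⊆ lower B := fun _ hz =>
  ⟨fun hzB => hz.1 (h hzB), fun hb => hz.2
    (hb.mono (image_mono (connectedComponentIn_mono _ (compl_subset_compl.2 h))))⟩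

theorem closure_lower_subset (hB : IsClosed B) (hb : BddBelow (Prod.snd '' B)) :
    closure (lower B) ⊆ lower B ∪ B := by
  have := closure_upper_subset (hB.preimage reflect.continuous) (bddAbove_reflect.2 hb)
  rw [lower_eq_reflect, ← reflect.preimage_closure]
  nth_rewrite 3 [← reflect_preimage_preimage B]
  exact preimage_mono this

theorem isPreconnected_lower_union (hB : IsClosed B) (hb : BddBelow (Prod.snd '' B))
    (hc : IsConnected B) : IsPreconnected (lower B ∪ B) := by
  have := isPreconnected_upper_union (hB.preimage reflect.continuous) (bddAbove_reflect.2 hb)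
    (by rw [← image_reflect]; exact hc.image _ reflect.continuous.continuousOn)
  have h2 := this.image reflect reflect.continuous.continuousOn
  rwa [image_reflect, preimage_union, reflect_preimage_preimage, ← lower_eq_reflect] at h2

theorem isPreconnected_compl_lower (hB : IsClosed B) (hb : BddBelow (Prod.snd '' B))
    (hc : IsConnected B) : IsPreconnected (lower B)ᶜ := by
  have := isPreconnected_compl_upper (hB.preimage reflect.continuous) (bddAbove_reflect.2 hb)
    (by rw [← image_reflect]; exact hc.image _ reflect.continuous.continuousOn)
  have h2 := this.image reflect reflect.continuous.continuousOn
  rwa [image_reflect, preimage_compl, ← lower_eq_reflect] at h2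

end Lower

end Annulus

namespace Annulus

variable {n : ℕ}

/-! ### Homeomorphisms with bounded vertical displacement -/

/-- The homeomorphisms of the annulus that move the last coordinate by a bounded amount. They
fix the two ends of the annulus. -/
def boundedDisplacement (n : ℕ) : Subgroup (Annulus n ≃ₜ Annulus n) where
  carrier := {F | ∃ K : ℝ, ∀ z, |(F z).2 - z.2| ≤ K}
  one_mem' := ⟨0, fun z => by simp⟩
  mul_mem' := by
    rintro F G ⟨K, hK⟩ ⟨K', hK'⟩
    refine ⟨K + K', fun z => ?_⟩
    have h := abs_add_le ((F (G z)).2 - (G z).2) ((G z).2 - z.2)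
    rw [sub_add_sub_cancel] at h
    exact h.trans (add_le_add (hK _) (hK' _))
  inv_mem' := by
    rintro F ⟨K, hK⟩
    refine ⟨K, fun z => ?_⟩
    have := hK (F.symm z)
    rw [Homeomorph.apply_symm_apply, abs_sub_comm] at this
    exact this

theorem bddAbove_image_of_mem_boundedDisplacement {F : Annulus n ≃ₜ Annulus n}
    (hF : F ∈ boundedDisplacement n) {B : Set (Annulus n)} (hB : BddAbove (Prod.snd '' B)) :
    BddAbove (Prod.snd '' (F '' B)) := by
  obtain ⟨K, hK⟩ := hF
  obtain ⟨M, hM⟩ := hB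
  refine ⟨M + K, ?_⟩
  rintro _ ⟨_, ⟨z, hz, rfl⟩, rfl⟩
  have h1 := hM ⟨z, hz, rfl⟩
  have h2 := (abs_le.1 (hK z)).2
  linarith

theorem bddBelow_image_of_mem_boundedDisplacement {F : Annulus n ≃ₜ Annulus n}
    (hF : F ∈ boundedDisplacement n) {B : Set (Annulus n)} (hB : BddBelow (Prod.snd '' B)) :
    BddBelow (Prod.snd '' (F '' B)) := by
  obtain ⟨K, hK⟩ := hF
  obtain ⟨M, hM⟩ := hB
  refine ⟨M - K, ?_⟩
  rintro _ ⟨_, ⟨z, hz, rfl⟩, rfl⟩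
  have h1 := hM ⟨z, hz, rfl⟩
  have h2 := (abs_le.1 (hK z)).1
  linarith

theorem image_symm_image (F : Annulus n ≃ₜ Annulus n) (B : Set (Annulus n)) :
    (F⁻¹ : Annulus n ≃ₜ Annulus n) '' (F '' B) = B :=
  F.toEquiv.symm_image_image B

theorem image_upper {F : Annulus n ≃ₜ Annulus n} (hF : F ∈ boundedDisplacement n)
    (B : Set (Annulus n)) : F '' upper B = upper (F '' B) := by
  have key : ∀ G ∈ boundedDisplacement n, ∀ B, G '' upper B ⊆ upper (G '' B) := by
    rintro G hG B _ ⟨z, hz, rfl⟩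
    have hzc : G z ∈ (G '' B)ᶜ := by
      rintro ⟨w, hw, hwz⟩
      exact hz.1 (G.injective hwz ▸ hw)
    refine ⟨hzc, fun hb => hz.2 ?_⟩
    have h1 : G '' connectedComponentIn Bᶜ z = connectedComponentIn (G '' B)ᶜ (G z) := by
      rw [G.image_connectedComponentIn hz.1, image_compl_eq G.bijective]
    rw [← h1] at hb
    have h2 := bddAbove_image_of_mem_boundedDisplacement (inv_mem hG) hb
    rwa [image_symm_image] at h2
  refine (key F hF B).antisymm fun z hz => ?_
  have := key F⁻¹ (inv_mem hF) _ (mem_image_of_mem _ hz)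
  rw [image_symm_image] at this
  exact ⟨_, this, F.apply_symm_apply z⟩

theorem image_lower {F : Annulus n ≃ₜ Annulus n} (hF : F ∈ boundedDisplacement n)
    (B : Set (Annulus n)) : F '' lower B = lower (F '' B) := by
  have key : ∀ G ∈ boundedDisplacement n, ∀ B, G '' lower B ⊆ lower (G '' B) := by
    rintro G hG B _ ⟨z, hz, rfl⟩
    have hzc : G z ∈ (G '' B)ᶜ := by
      rintro ⟨w, hw, hwz⟩
      exact hz.1 (G.injective hwz ▸ hw)
    refine ⟨hzc, fun hb => hz.2 ?_⟩
    have h1 : G '' connectedComponentIn Bᶜ z = connectedComponentIn (G '' B)ᶜ (G z) := by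
      rw [G.image_connectedComponentIn hz.1, image_compl_eq G.bijective]
    rw [← h1] at hb
    have h2 := bddBelow_image_of_mem_boundedDisplacement (inv_mem hG) hb
    rwa [image_symm_image] at h2
  refine (key F hF B).antisymm fun z hz => ?_
  have := key F⁻¹ (inv_mem hF) _ (mem_image_of_mem _ hz)
  rw [image_symm_image] at this
  exact ⟨_, this, F.apply_symm_apply z⟩

/-! ### Essential continua and their order -/

theorem _root_.IsCompact.bddAbove_snd {B : Set (Annulus n)} (hB : IsCompact B) :
    BddAbove (Prod.snd '' B) := (hB.image continuous_snd).bddAbove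

theorem _root_.IsCompact.bddBelow_snd {B : Set (Annulus n)} (hB : IsCompact B) :
    BddBelow (Prod.snd '' B) := (hB.image continuous_snd).bddBelow

theorem isBounded_iff_snd {B : Set (Annulus n)} :
    Bornology.IsBounded B ↔ BddBelow (Prod.snd '' B) ∧ BddAbove (Prod.snd '' B) := by
  rw [← isBounded_iff_bddBelow_bddAbove]
  refine ⟨fun h => h.image_snd, fun h => ?_⟩
  refine ((isCompact_univ.isBounded (s := (univ : Set (Torus n)))).prod h).subset fun z hz => ?_
  exact ⟨trivial, mem_image_of_mem _ hz⟩

/-- As the torus factor is compact, an unbounded component is unbounded above or below. -/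
theorem isEssentialContinuum_iff {E : Set (Annulus n)} :
    IsEssentialContinuum E ↔ IsCompact E ∧ IsConnected E ∧ Disjoint (upper E) (lower E) := by
  refine and_congr_right fun hE => and_congr_right fun _ => ?_
  constructor
  · rintro ⟨z, hz, w, hw, hne, hbz, hbw⟩
    have hcases : ∀ v ∈ Eᶜ, ¬ Bornology.IsBounded (connectedComponentIn Eᶜ v) →
        v ∈ upper E ∨ v ∈ lower E := by
      intro v hv hb
      rw [isBounded_iff_snd, not_and_or] at hb
      exact hb.symm.imp (⟨hv, ·⟩) (⟨hv, ·⟩)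
    have hU : ∀ {a b}, a ∈ upper E → b ∈ upper E → b ∈ connectedComponentIn Eᶜ a :=
      fun ha hb => (isPreconnected_upper hE.bddAbove_snd).subset_connectedComponentIn ha
        upper_subset_compl hb
    have hL : ∀ {a b}, a ∈ lower E → b ∈ lower E → b ∈ connectedComponentIn Eᶜ a :=
      fun ha hb => (isPreconnected_lower hE.bddBelow_snd).subset_connectedComponentIn ha
        lower_subset_compl hb
    rw [disjoint_left]
    intro p hpu hpl
    have hmem : ∀ v, v ∈ upper E ∨ v ∈ lower E → v ∈ connectedComponentIn Eᶜ p :=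
      fun v hv => hv.elim (hU hpu) (hL hpl)
    apply hne
    rw [← connectedComponentIn_eq (hmem z (hcases z hz hbz)),
      ← connectedComponentIn_eq (hmem w (hcases w hw hbw))]
  · intro hdis
    obtain ⟨z, hz⟩ := upper_nonempty hE.bddAbove_snd
    obtain ⟨w, hw⟩ := lower_nonempty hE.bddBelow_snd
    refine ⟨z, hz.1, w, hw.1, fun heq => ?_, fun hb => hz.2 (isBounded_iff_snd.1 hb).2,
      fun hb => hw.2 (isBounded_iff_snd.1 hb).1⟩
    exact hdis.notMem_of_mem_left hz ⟨hz.1, heq ▸ hw.2⟩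

theorem IsEssentialContinuum.disjoint {E : Set (Annulus n)} (hE : IsEssentialContinuum E) :
    Disjoint (upper E) (lower E) := (isEssentialContinuum_iff.1 hE).2.2

theorem IsEssentialContinuum.image {E : Set (Annulus n)} (hE : IsEssentialContinuum E)
    {F : Annulus n ≃ₜ Annulus n} (hF : F ∈ boundedDisplacement n) :
    IsEssentialContinuum (F '' E) := by
  rw [isEssentialContinuum_iff] at hE ⊢
  refine ⟨hE.1.image F.continuous, hE.2.1.image _ F.continuous.continuousOn, ?_⟩
  rw [← image_upper hF, ← image_lower hF]
  exact (disjoint_image_iff F.injective).2 hE.2.2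

section Order

variable {A B C : Set (Annulus n)}

/-- If `B` were in a bounded component of the complement of `A`, then `A` and the two unbounded
components would form a connected set that joins the two ends in the complement of `B`. -/
theorem IsEssentialContinuum.subset_upper_or_subset_lower (hA : IsEssentialContinuum A)
    (hB : IsEssentialContinuum B) (hAB : Disjoint A B) : B ⊆ upper A ∨ B ⊆ lower A := by
  by_contra! hno
  have hBA : B ⊆ Aᶜ := hAB.subset_compl_left
  have hU : Disjoint (upper A ∪ A) B := by
    refine disjoint_union_left.2 ⟨?_, hAB⟩
    rw [disjoint_iff_inter_eq_empty, inter_comm]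
    exact not_nonempty_iff_eq_empty.1 fun h => hno.1 (hB.2.1.2.subset_upper hBA h)
  have hL : Disjoint (lower A ∪ A) B := by
    refine disjoint_union_left.2 ⟨?_, hAB⟩
    rw [disjoint_iff_inter_eq_empty, inter_comm]
    exact not_nonempty_iff_eq_empty.1 fun h => hno.2 (hB.2.1.2.subset_lower hBA h)
  have h1 : upper A ∪ A ⊆ upper B :=
    (isPreconnected_upper_union hA.1.isClosed hA.1.bddAbove_snd hA.2.1).subset_upper_of_not_bddAbove
      hU.subset_compl_right fun hb => not_bddAbove_upper hA.1.bddAbove_snd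
        (hb.mono (image_mono subset_union_left))
  have h2 : lower A ∪ A ⊆ lower B :=
    (isPreconnected_lower_union hA.1.isClosed hA.1.bddBelow_snd hA.2.1).subset_lower_of_not_bddBelow
      hL.subset_compl_right fun hb => not_bddBelow_lower hA.1.bddBelow_snd
        (hb.mono (image_mono subset_union_left))
  obtain ⟨a, ha⟩ := hA.2.1.1
  exact hB.disjoint.notMem_of_mem_left (h1 (Or.inr ha)) (h2 (Or.inr ha))

theorem IsEssentialContinuum.lower_union_subset (hA : IsEssentialContinuum A)
    (h : B ⊆ upper A) : lower A ∪ A ⊆ lower B := by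
  refine (isPreconnected_lower_union hA.1.isClosed hA.1.bddBelow_snd
    hA.2.1).subset_lower_of_not_bddBelow ?_ fun hb => not_bddBelow_lower hA.1.bddBelow_snd
        (hb.mono (image_mono subset_union_left))
  rintro z (hz | hz) hzB
  · exact hA.disjoint.notMem_of_mem_left (h hzB) hz
  · exact (h hzB).1 hz

theorem IsEssentialContinuum.upper_union_subset (hA : IsEssentialContinuum A)
    (h : B ⊆ lower A) : upper A ∪ A ⊆ upper B := by
  refine (isPreconnected_upper_union hA.1.isClosed hA.1.bddAbove_snd
    hA.2.1).subset_upper_of_not_bddAbove ?_ fun hb => not_bddAbove_upper hA.1.bddAbove_snd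
        (hb.mono (image_mono subset_union_left))
  rintro z (hz | hz) hzB
  · exact hA.disjoint.notMem_of_mem_left hz (h hzB)
  · exact (h hzB).1 hz

theorem Precedes.subset_lower (h : Precedes A B) (hA : IsEssentialContinuum A) : A ⊆ lower B :=
  subset_union_right.trans (hA.lower_union_subset h)

theorem Precedes.trans (hAB : Precedes A B) (hBC : Precedes B C) (hA : IsEssentialContinuum A)
    (hB : IsEssentialContinuum B) : Precedes A C :=
  Subset.trans hBC (Subset.trans subset_union_left
    (hB.upper_union_subset (hAB.subset_lower hA)))

theorem IsEssentialContinuum.precedes_or_precedes (hA : IsEssentialContinuum A)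
    (hB : IsEssentialContinuum B) (hAB : Disjoint A B) : Precedes A B ∨ Precedes B A :=
  (hA.subset_upper_or_subset_lower hB hAB).imp id fun h =>
    subset_union_right.trans (hA.upper_union_subset h)

theorem Precedes.not_precedes (hAB : Precedes A B) (hA : IsEssentialContinuum A)
    (hB : IsEssentialContinuum B) : ¬ Precedes B A := fun hBA => by
  obtain ⟨a, ha⟩ := hA.2.1.1
  exact hB.disjoint.notMem_of_mem_left (hBA ha) (hAB.subset_lower hA ha)

theorem Precedes.image {F : Annulus n ≃ₜ Annulus n} (hF : F ∈ boundedDisplacement n)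
    (h : Precedes A B) : Precedes (F '' A) (F '' B) := by
  rw [Precedes, ← image_upper hF]
  exact image_mono h

end Order

end Annulus

/-! ### Height functions of nested families of open sets -/

section HeightFunction

variable {X ι : Type*} [TopologicalSpace X] {val : ι → ℝ} {W : ι → Set X}

/-- A family of open sets, indexed so that the values `val i` are dense in `ℝ`, which is nested
with respect to `val`, has union `univ` and empty intersection. -/
structure IsNestedFamily (val : ι → ℝ) (W : ι → Set X) : Prop where
  dense : DenseRange val
  isOpen : ∀ i, IsOpen (W i)
  closure_subset : ∀ i j, val i < val j → closure (W i) ⊆ W j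
  exists_mem : ∀ z, ∃ i, z ∈ W i
  exists_notMem : ∀ z, ∃ i, z ∉ W i

/-- The height function of a family of sets: the infimum of the values of the sets that
contain a given point. It is meaningful for nested families only, for which this infimum is taken
over a nonempty set that is bounded below. -/
noncomputable def heightFunction (val : ι → ℝ) (W : ι → Set X) (z : X) : ℝ :=
  sInf (val '' {i | z ∈ W i})

namespace IsNestedFamily

theorem mono (h : IsNestedFamily val W) {i j : ι} (hij : val i < val j) : W i ⊆ W j :=
  subset_closure.trans (h.closure_subset i j hij)

theorem exists_between (h : IsNestedFamily val W) {a b : ℝ} (hab : a < b) :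
    ∃ i, a < val i ∧ val i < b := by
  obtain ⟨_, ⟨i, rfl⟩, hi⟩ := h.dense.exists_between hab
  exact ⟨i, hi⟩

theorem bddBelow (h : IsNestedFamily val W) (z : X) : BddBelow (val '' {i | z ∈ W i}) := by
  obtain ⟨i₀, h₀⟩ := h.exists_notMem z
  refine ⟨val i₀, ?_⟩
  rintro _ ⟨i, hi, rfl⟩
  exact not_lt.1 fun hlt => h₀ (h.mono hlt hi)

theorem heightFunction_lt_iff (h : IsNestedFamily val W) {z : X} {s : ℝ} :
    heightFunction val W z < s ↔ ∃ i, val i < s ∧ z ∈ W i := by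
  obtain ⟨i₀, h₀⟩ := h.exists_mem z
  rw [heightFunction, csInf_lt_iff (h.bddBelow z) ⟨_, i₀, h₀, rfl⟩]
  constructor
  · rintro ⟨_, ⟨i, hi, rfl⟩, his⟩
    exact ⟨i, his, hi⟩
  · rintro ⟨i, his, hi⟩
    exact ⟨_, ⟨i, hi, rfl⟩, his⟩

theorem lt_heightFunction_iff (h : IsNestedFamily val W) {z : X} {s : ℝ} :
    s < heightFunction val W z ↔ ∃ i, s < val i ∧ z ∉ W i := by
  constructor
  · intro hs
    obtain ⟨i, hi, hi'⟩ := h.exists_between hs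
    exact ⟨i, hi, fun hz => hi'.not_ge (csInf_le (h.bddBelow z) ⟨i, hz, rfl⟩)⟩
  · rintro ⟨i, his, hi⟩
    refine his.trans_le (not_lt.1 fun hlt => ?_)
    obtain ⟨j, hj, hjz⟩ := h.heightFunction_lt_iff.1 hlt
    exact hi (h.mono hj hjz)

theorem continuous (h : IsNestedFamily val W) : Continuous (heightFunction val W) := by
  refine OrderTopology.continuous_iff.2 fun s => ⟨?_, ?_⟩
  · have : heightFunction val W ⁻¹' Ioi s = ⋃ i, ⋃ (_ : s < val i), (closure (W i))ᶜ := by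
      ext z
      simp only [mem_preimage, mem_Ioi, mem_iUnion, exists_prop, mem_compl_iff]
      rw [h.lt_heightFunction_iff]
      constructor
      · rintro ⟨i, his, hi⟩
        obtain ⟨j, hj, hj'⟩ := h.exists_between his
        exact ⟨j, hj, fun hz => hi (h.closure_subset j i hj' hz)⟩
      · rintro ⟨i, his, hi⟩
        exact ⟨i, his, fun hz => hi (subset_closure hz)⟩
    rw [this]
    exact isOpen_iUnion fun i => isOpen_iUnion fun _ => isClosed_closure.isOpen_compl
  · have : heightFunction val W ⁻¹' Iio s = ⋃ i, ⋃ (_ : val i < s), W i := by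
      ext z
      simp only [mem_preimage, mem_Iio, mem_iUnion, exists_prop]
      exact h.heightFunction_lt_iff
    rw [this]
    exact isOpen_iUnion fun i => isOpen_iUnion fun _ => h.isOpen i

theorem isPreconnected_lt (h : IsNestedFamily val W) (hc : ∀ i, IsPreconnected (W i)) (s : ℝ) :
    IsPreconnected {z | heightFunction val W z < s} := by
  refine isPreconnected_of_forall_pair fun x hx y hy => ?_
  obtain ⟨i, hi, hxi⟩ := h.heightFunction_lt_iff.1 hx
  obtain ⟨j, hj, hyj⟩ := h.heightFunction_lt_iff.1 hy
  obtain ⟨k, hk, hk'⟩ := h.exists_between (max_lt hi hj)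
  refine ⟨W k, fun z hz => h.heightFunction_lt_iff.2 ⟨k, hk', hz⟩, ?_, ?_, hc k⟩
  · exact h.mono ((le_max_left _ _).trans_lt hk) hxi
  · exact h.mono ((le_max_right _ _).trans_lt hk) hyj

theorem isPreconnected_gt (h : IsNestedFamily val W) (hc : ∀ i, IsPreconnected (W i)ᶜ) (s : ℝ) :
    IsPreconnected {z | s < heightFunction val W z} := by
  refine isPreconnected_of_forall_pair fun x hx y hy => ?_
  obtain ⟨i, hi, hxi⟩ := h.lt_heightFunction_iff.1 hx
  obtain ⟨j, hj, hyj⟩ := h.lt_heightFunction_iff.1 hy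
  obtain ⟨k, hk, hk'⟩ := h.exists_between (lt_min hi hj)
  refine ⟨(W k)ᶜ, fun z hz => h.lt_heightFunction_iff.2 ⟨k, hk, hz⟩, ?_, ?_, hc k⟩
  · exact fun hx => hxi (h.mono (hk'.trans_le (min_le_left _ _)) hx)
  · exact fun hy => hyj (h.mono (hk'.trans_le (min_le_right _ _)) hy)

/-- A bijection that translates the family translates the height function. -/
theorem heightFunction_apply (h : IsNestedFamily val W) (F : X ≃ₜ X) (σ : ι → ι)
    (hσ : Function.Surjective σ) (c : ℝ) (hval : ∀ i, val (σ i) = val i + c)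
    (hW : ∀ i, F '' W i = W (σ i)) (z : X) :
    heightFunction val W (F z) = heightFunction val W z + c := by
  refine eq_of_forall_gt_iff fun s => ?_
  rw [← lt_sub_iff_add_lt, h.heightFunction_lt_iff, h.heightFunction_lt_iff, hσ.exists]
  refine exists_congr fun i => ?_
  rw [hval, lt_sub_iff_add_lt, ← hW, F.injective.mem_set_image]

end IsNestedFamily

end HeightFunction

/-! ### Lifting maps to the circle -/

theorem UnitAddCircle.coe_eq_coe_iff {x y : ℝ} :
    (x : UnitAddCircle) = y ↔ ∃ m : ℤ, x = y + m := by
  rw [← sub_eq_zero, ← AddCircle.coe_sub, AddCircle.coe_eq_zero_iff]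
  refine exists_congr fun m => ?_
  rw [zsmul_one, eq_comm, sub_eq_iff_eq_add']

theorem IsPreconnected.eq_of_intCast {X : Type*} [TopologicalSpace X] {S : Set X}
    (hS : IsPreconnected S) {f : X → ℝ} (hf : ContinuousOn f S) (hint : ∀ x ∈ S, ∃ m : ℤ, f x = m)
    {x y : X} (hx : x ∈ S) (hy : y ∈ S) : f x = f y := by
  refine hS.constant_of_mapsTo (T := range ((↑) : ℤ → ℝ)) ?_ hf
    (fun z hz => (hint z hz).imp fun m hm => hm.symm) hx hy
  rw [isDiscrete_iff_discreteTopology]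
  exact Int.isClosedEmbedding_coe_real.isEmbedding.toHomeomorph.symm.isEmbedding.discreteTopology

theorem exists_real_lift_of_homotopy {A : Type*} [TopologicalSpace A]
    (g : C(unitInterval × A, UnitAddCircle)) (hg : ∀ a, g (0, a) = 0) :
    ∃ G : C(unitInterval × A, ℝ), ∀ p, (G p : UnitAddCircle) = g p := by
  let cov := AddCircle.isCoveringMap_coe (1 : ℝ)
  have h0 : ∀ a, g (0, a) = (((0 : C(A, ℝ)) a : ℝ) : UnitAddCircle) := fun a => by simp [hg a]
  exact ⟨cov.liftHomotopy g 0 h0, congrFun (cov.liftHomotopy_lifts g 0 h0)⟩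

namespace Annulus

variable {n : ℕ}

/-- A map to the circle that vanishes near the ends of the annulus lifts to the line: it is
null-homotopic, as it can be contracted by pushing towards one end. -/
theorem exists_real_lift {g : Annulus n → UnitAddCircle} (hg : Continuous g) {M : ℝ} (hM : 0 < M)
    (h0 : ∀ z, M ≤ |z.2| → g z = 0) :
    ∃ G : Annulus n → ℝ, Continuous G ∧ ∀ z, (G z : UnitAddCircle) = g z := by
  obtain ⟨G, hG⟩ := exists_real_lift_of_homotopy (A := Torus n)
    ⟨fun p => g (p.2, M * (2 * p.1 - 1)), by fun_prop⟩
    (fun a => h0 _ (by simp [abs_of_pos hM]))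
  have hMM : (-M) ≤ M := by linarith
  refine ⟨fun z => G (projIcc 0 1 zero_le_one ((z.2 / M + 1) / 2), z.1), ?_, fun z => ?_⟩
  · have : Continuous fun z : Annulus n => projIcc (0 : ℝ) 1 zero_le_one ((z.2 / M + 1) / 2) :=
      continuous_projIcc.comp (by fun_prop)
    fun_prop
  · rw [hG]
    simp only [ContinuousMap.coe_mk]
    rcases le_or_gt M |z.2| with h | h
    · rw [h0 z h]
      apply h0
      rcases le_abs.1 h with h' | h'
      · rw [projIcc_of_right_le]
        · norm_num [abs_of_pos hM]
        · have : 1 ≤ z.2 / M := (one_le_div hM).2 h'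
          linarith
      · rw [projIcc_of_le_left]
        · simp [abs_of_pos hM]
        · have : 1 ≤ -z.2 / M := (one_le_div hM).2 h'
          rw [neg_div] at this
          linarith
    · rw [abs_lt] at h
      have h1 : -1 ≤ z.2 / M := by rw [le_div_iff₀ hM]; linarith
      have h2 : z.2 / M ≤ 1 := by rw [div_le_iff₀ hM]; linarith
      rw [projIcc_of_mem _ (show (z.2 / M + 1) / 2 ∈ Icc (0 : ℝ) 1 from
        ⟨by linarith, by linarith⟩)]
      congr 1
      ext
      · rfl
      · field_simp
        ring

/-! ### Connectedness of the level sets of a height function -/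

/-- A form of unicoherence. If `{r < H < s}` splits into open sets `P` and `Q`, then the map to
the circle that winds once across `P` and is constant elsewhere has a real lift `G`. On `{r < H}`
and on `{H < s}` the lift agrees up to constants with explicit functions, and these constants
coincide on `P` but differ on `Q`. -/
theorem isPreconnected_between {H : Annulus n → ℝ} (hH : Continuous H) {r s : ℝ} (hrs : r < s)
    (hgt : IsPreconnected {z | r < H z}) (hlt : IsPreconnected {z | H z < s}) {M : ℝ}
    (hM : 0 < M) (hend : ∀ z, M ≤ |z.2| → ¬ (r < H z ∧ H z < s)) :
    IsPreconnected {z | r < H z ∧ H z < s} := by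
  classical
  have hO : IsOpen {z | r < H z ∧ H z < s} :=
    (isOpen_lt continuous_const hH).inter (isOpen_lt hH continuous_const)
  rw [isPreconnected_iff_subset_of_disjoint]
  intro u v hu hv huv hdis
  by_contra! hno
  obtain ⟨⟨q, hq, hqu⟩, ⟨p, hp, hpv⟩⟩ := And.imp not_subset.1 not_subset.1 hno
  have hpu := (huv hp).resolve_right hpv
  set P := {z | r < H z ∧ H z < s} ∩ u with hP
  have hPo : IsOpen P := hO.inter hu
  have hfr : ∀ z ∈ frontier P, H z = r ∨ H z = s := by
    intro z hz
    have hcl : r ≤ H z ∧ H z ≤ s := by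
      have : IsClosed {z | r ≤ H z ∧ H z ≤ s} :=
        (isClosed_le continuous_const hH).inter (isClosed_le hH continuous_const)
      exact this.closure_subset_iff.2 (fun w hw => ⟨hw.1.1.le, hw.1.2.le⟩) hz.1
    by_contra! hne
    have hzO : r < H z ∧ H z < s := ⟨hcl.1.lt_of_ne' hne.1, hcl.2.lt_of_ne hne.2⟩
    rw [hPo.frontier_eq] at hz
    have hzu : z ∉ u := fun h => hz.2 ⟨hzO, h⟩
    obtain ⟨w, hw, hwP⟩ := mem_closure_iff.1 hz.1 v hv ((huv hzO).resolve_left hzu)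
    exact eq_empty_iff_forall_notMem.1 hdis w ⟨hwP.1, hwP.2, hw⟩
  have hd : 0 < s - r := sub_pos.2 hrs
  set c : Annulus n → ℝ := fun z => (H z - r) / (s - r) with hc
  have hcc : Continuous c := by fun_prop
  have hcr : ∀ z, H z = r → c z = 0 := fun z hz => by simp [hc, hz]
  have hcs : ∀ z, H z = s → c z = 1 := fun z hz => by simp [hc, hz, hd.ne']
  have h01 : ((1 : ℝ) : UnitAddCircle) = 0 := AddCircle.coe_period 1
  obtain ⟨G, hG, hGg⟩ := exists_real_lift (n := n)
    (g := P.piecewise (fun z => (c z : UnitAddCircle)) 0)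
    (Continuous.piecewise (fun z hz => by
      rcases hfr z hz with h | h
      · simp [hcr z h]
      · simp [hcs z h, h01]) ((AddCircle.continuous_mk' 1).comp hcc) continuous_const)
    hM (fun z hz => piecewise_eq_of_notMem _ _ _ fun hzP => hend z hz hzP.1)
  have key : ∀ (S : Set (Annulus n)) (k : ℝ), (k : UnitAddCircle) = 0 → IsPreconnected S →
      (∀ z ∈ S ∩ frontier P, c z = k) → p ∈ S → q ∈ S → G p - c p = G q - k := by
    intro S k hk hS hSf hpS hqS
    have hcont : ContinuousOn (fun z => G z - P.piecewise c (fun _ => k) z) S :=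
      hG.continuousOn.sub (ContinuousOn.piecewise hSf hcc.continuousOn continuousOn_const)
    have := hS.eq_of_intCast hcont (fun z _ => ?_) hpS hqS
    · have hpP : p ∈ P := ⟨hp, hpu⟩
      have hqP : q ∉ P := fun h => hqu h.2
      simpa only [piecewise_eq_of_mem _ _ _ hpP, piecewise_eq_of_notMem _ _ _ hqP] using this
    · have h1 : (G z : UnitAddCircle) = (P.piecewise c (fun _ => k) z : ℝ) := by
        rw [hGg]
        by_cases hz : z ∈ P
        · simp only [piecewise_eq_of_mem _ _ _ hz]
        · simp only [piecewise_eq_of_notMem _ _ _ hz, hk, Pi.zero_apply]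
      obtain ⟨m, hm⟩ := UnitAddCircle.coe_eq_coe_iff.1 h1
      exact ⟨m, by rw [hm]; ring⟩
  have e1 := key _ 1 h01 hgt (fun z hz => (hfr z hz.2).elim
    (fun h => absurd hz.1 (by simp [h])) (hcs z)) hp.1 hq.1
  have e0 := key _ 0 (by simp) hlt (fun z hz => (hfr z hz.2).elim (hcr z)
    (fun h => absurd hz.1 (by simp [h]))) hp.2 hq.2
  linarith

/-- A continuous function on the annulus at bounded distance from the last coordinate, whose
strict sublevel and superlevel sets are connected. -/
structure IsHeight (H : Annulus n → ℝ) : Prop where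
  continuous : Continuous H
  bdd : ∃ K : ℝ, ∀ z, |H z - z.2| ≤ K
  isPreconnected_lt : ∀ s, IsPreconnected {z | H z < s}
  isPreconnected_gt : ∀ s, IsPreconnected {z | s < H z}

theorem surjective_of_bdd {H : Annulus n → ℝ} (hH : Continuous H) {K : ℝ}
    (hK : ∀ z, |H z - z.2| ≤ K) : Function.Surjective H := by
  intro s
  refine mem_range_of_exists_le_of_exists_ge hH ⟨(0, s - K), ?_⟩ ⟨(0, s + K), ?_⟩
  · linarith [(abs_le.1 (hK (0, s - K))).2]
  · linarith [(abs_le.1 (hK (0, s + K))).1]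

theorem isCompact_of_bdd {H : Annulus n → ℝ} {K : ℝ} (hK : ∀ z, |H z - z.2| ≤ K)
    {C : Set (Annulus n)} (hC : IsClosed C) {a b : ℝ} (hab : ∀ z ∈ C, a ≤ H z ∧ H z ≤ b) :
    IsCompact C := by
  refine (isCompact_univ.prod (isCompact_Icc (a := a - K) (b := b + K))).of_isClosed_subset hC
    fun z hz => ⟨mem_univ _, ?_⟩
  have h1 := abs_le.1 (hK z)
  have h2 := hab z hz
  exact ⟨by linarith, by linarith⟩

namespace IsHeight

variable {H : Annulus n → ℝ}

theorem isCompact_level (hH : IsHeight H) (s : ℝ) : IsCompact {z | H z = s} := by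
  obtain ⟨K, hK⟩ := hH.bdd
  exact isCompact_of_bdd hK (isClosed_eq hH.continuous continuous_const)
    (a := s) (b := s) fun z hz => ⟨hz.ge, hz.le⟩

theorem isConnected_level (hH : IsHeight H) (s : ℝ) : IsConnected {z | H z = s} := by
  obtain ⟨K, hK⟩ := hH.bdd
  refine ⟨surjective_of_bdd hH.continuous hK s, ?_⟩
  let B : {ε : ℝ // 0 < ε} → Set (Annulus n) := fun ε =>
    closure {z | s - ε.1 < H z ∧ H z < s + ε.1}
  have hB : ∀ ε, ∀ z ∈ B ε, s - ε.1 ≤ H z ∧ H z ≤ s + ε.1 := by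
    intro ε z hz
    have : IsClosed {z | s - ε.1 ≤ H z ∧ H z ≤ s + ε.1} :=
      (isClosed_le continuous_const hH.continuous).inter
        (isClosed_le hH.continuous continuous_const)
    exact this.closure_subset_iff.2 (fun w hw => ⟨hw.1.le, hw.2.le⟩) hz
  have heq : {z | H z = s} = ⋂ ε, B ε := by
    ext z
    rw [mem_iInter]
    refine ⟨fun hz ε => subset_closure ⟨?_, ?_⟩, fun hz => ?_⟩
    · rw [hz.out]; linarith [ε.2]
    · rw [hz.out]; linarith [ε.2]
    · exact le_antisymm (le_of_forall_pos_le_add fun ε hε => (hB ⟨ε, hε⟩ z (hz _)).2)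
        (le_of_forall_pos_le_add fun ε hε => by linarith [(hB ⟨ε, hε⟩ z (hz ⟨ε, hε⟩)).1])
  have : Nonempty {ε : ℝ // 0 < ε} := ⟨⟨1, one_pos⟩⟩
  rw [heq]
  refine IsPreconnected.iInter_of_directed ?_ (fun ε => ?_) (fun ε => ?_)
  · intro ε δ
    refine ⟨⟨min ε.1 δ.1, lt_min ε.2 δ.2⟩, closure_mono fun z hz => ?_,
      closure_mono fun z hz => ?_⟩
    · exact ⟨by linarith [hz.1, min_le_left ε.1 δ.1], by linarith [hz.2, min_le_left ε.1 δ.1]⟩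
    · exact ⟨by linarith [hz.1, min_le_right ε.1 δ.1], by linarith [hz.2, min_le_right ε.1 δ.1]⟩
  · exact isCompact_of_bdd hK isClosed_closure (hB ε)
  · refine (isPreconnected_between hH.continuous (by linarith [ε.2]) (hH.isPreconnected_gt _)
      (hH.isPreconnected_lt _) (M := |s| + ε.1 + |K| + 1) (by positivity [ε.2]) ?_).closure
    rintro z hz ⟨h1, h2⟩
    have h3 := abs_le.1 (hK z)
    have h4 : |z.2| < |s| + ε.1 + |K| + 1 := by
      rw [abs_lt]
      constructor <;> linarith [neg_abs_le s, le_abs_self s, le_abs_self K]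
    linarith

end IsHeight

end Annulus

/-! ### Lifts of torus homeomorphisms to the annulus -/

namespace Annulus

variable {n : ℕ}

@[simp] theorem last_proj (z : Annulus n) : proj z (Fin.last n) = z.2 := by simp [proj]

@[simp] theorem init_proj (z : Annulus n) : Fin.init (proj z) = z.1 := by
  simp [proj]

theorem isOpenQuotientMap_proj : IsOpenQuotientMap (proj : Annulus n → Torus (n + 1)) := by
  let e : Torus n × UnitAddCircle ≃ₜ Torus (n + 1) :=
    { toFun := fun p => Fin.snoc (α := fun _ => UnitAddCircle) p.1 p.2
      invFun := fun y => (Fin.init y, y (Fin.last n))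
      left_inv := fun p => by simp
      right_inv := fun y => by simp
      continuous_toFun := Continuous.finSnoc (A := fun _ => UnitAddCircle) continuous_fst
        continuous_snd
      continuous_invFun := (continuous_id.finInit).prodMk (continuous_apply _) }
  exact e.isOpenQuotientMap.comp
    (IsOpenQuotientMap.id.prodMap QuotientAddGroup.isOpenQuotientMap_mk)

@[simp] theorem shift_snd (j : ℤ) (z : Annulus n) : (shift j z).2 = z.2 + j := rfl

theorem proj_eq_proj_iff {z w : Annulus n} : proj z = proj w ↔ ∃ j : ℤ, z = shift j w := by
  constructor
  · intro h
    obtain ⟨j, hj⟩ := UnitAddCircle.coe_eq_coe_iff.1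
      ((last_proj z).symm.trans ((congrFun h _).trans (last_proj w)))
    exact ⟨j, Prod.ext (by rw [← init_proj z, h, init_proj]; rfl) hj⟩
  · rintro ⟨j, rfl⟩
    have : ((w.2 + j : ℝ) : UnitAddCircle) = w.2 := UnitAddCircle.coe_eq_coe_iff.2 ⟨j, rfl⟩
    simp only [proj, shift, this]

/-- The integer translation as a homeomorphism. -/
def shiftHomeo (n : ℕ) (j : ℤ) : Annulus n ≃ₜ Annulus n :=
  (Homeomorph.refl _).prodCongr (Homeomorph.addRight (j : ℝ))

@[simp] theorem coe_shiftHomeo (j : ℤ) : ⇑(shiftHomeo n j) = shift j := rfl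

theorem shiftHomeo_mem_boundedDisplacement (j : ℤ) : shiftHomeo n j ∈ boundedDisplacement n :=
  ⟨|(j : ℝ)|, fun z => by simp⟩

theorem shift_shift (i j : ℤ) (z : Annulus n) : shift i (shift j z) = shift (i + j) z := by
  ext
  · rfl
  · simp only [shift_snd, Int.cast_add]; ring

@[simp] theorem shift_zero (z : Annulus n) : shift 0 z = z := by
  ext <;> simp [shift]

end Annulus

namespace Torus

open Annulus

variable {n : ℕ}

theorem isOpenQuotientMap_cover (L : Torus (n + 1) ≃ₜ+ Torus (n + 1)) :
    IsOpenQuotientMap (cover L) :=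
  L.toHomeomorph.isOpenQuotientMap.comp isOpenQuotientMap_proj

theorem cover_eq_cover_iff {L : Torus (n + 1) ≃ₜ+ Torus (n + 1)} {z w : Annulus n} :
    cover L z = cover L w ↔ ∃ j : ℤ, z = shift j w := by
  rw [← proj_eq_proj_iff]
  exact L.injective.eq_iff

@[simp] theorem cover_shift (L : Torus (n + 1) ≃ₜ+ Torus (n + 1)) (j : ℤ) (z : Annulus n) :
    cover L (shift j z) = cover L z := cover_eq_cover_iff.2 ⟨j, rfl⟩

/-- `F` is a lift of the torus homeomorphism `f` to the annulus that commutes with the integer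
translations and has bounded vertical displacement. -/
structure IsAnnularLift (L : Torus (n + 1) ≃ₜ+ Torus (n + 1)) (f : Torus (n + 1) ≃ₜ Torus (n + 1))
    (F : Annulus n ≃ₜ Annulus n) : Prop where
  cover_apply : ∀ z, cover L (F z) = f (cover L z)
  apply_shift : ∀ j z, F (shift j z) = shift j (F z)
  mem_boundedDisplacement : F ∈ boundedDisplacement n

/-- A homeomorphism homotopic to the identity lifts: the homotopy makes the last coordinate of the
displacement a null-homotopic map to the circle, so that it has a real lift. -/
theorem exists_isAnnularLift (f : Torus (n + 1) ≃ₜ Torus (n + 1))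
    (hf : ContinuousMap.Homotopic (f : C(Torus (n + 1), Torus (n + 1)))
      (ContinuousMap.id (Torus (n + 1)))) (L : Torus (n + 1) ≃ₜ+ Torus (n + 1)) :
    ∃ F, IsAnnularLift L f F := by
  obtain ⟨Γ⟩ := hf.symm
  let g : Torus (n + 1) ≃ₜ Torus (n + 1) := (L.toHomeomorph.trans f).trans L.toHomeomorph.symm
  obtain ⟨G, hG⟩ := exists_real_lift_of_homotopy (A := Torus (n + 1))
    ⟨fun p => L.symm (Γ (p.1, L p.2)) (Fin.last n) - p.2 (Fin.last n), by
      have h1 : Continuous L := L.continuous_toFun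
      have h2 : Continuous L.symm := L.continuous_invFun
      fun_prop⟩ (fun a => by simp)
  let φ : Torus (n + 1) → ℝ := fun y => G (1, y)
  have hφ : Continuous φ := by fun_prop
  have hφg : ∀ y, (φ y : UnitAddCircle) = g y (Fin.last n) - y (Fin.last n) := fun y => by
    simp only [φ, hG]
    simp only [ContinuousMap.coe_mk, Γ.apply_one]
    rfl
  have hpc : Continuous (proj : Annulus n → Torus (n + 1)) := isOpenQuotientMap_proj.continuous
  have hproj : ∀ z : Annulus n,
      proj (Fin.init (g (proj z)), z.2 + φ (proj z)) = g (proj z) := by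
    intro z
    have : ((z.2 + φ (proj z) : ℝ) : UnitAddCircle) = g (proj z) (Fin.last n) := by
      rw [AddCircle.coe_add, hφg, last_proj]
      abel
    change Fin.snoc (α := fun _ => UnitAddCircle) (Fin.init (g (proj z))) _ = _
    rw [this]
    exact Fin.snoc_init_self (α := fun _ => UnitAddCircle) _
  have hproj' : ∀ z : Annulus n,
      proj (Fin.init (g.symm (proj z)), z.2 - φ (g.symm (proj z))) = g.symm (proj z) := by
    intro z
    have : ((z.2 - φ (g.symm (proj z)) : ℝ) : UnitAddCircle) =
        g.symm (proj z) (Fin.last n) := by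
      rw [AddCircle.coe_sub, hφg, Homeomorph.apply_symm_apply, last_proj]
      abel
    change Fin.snoc (α := fun _ => UnitAddCircle) (Fin.init (g.symm (proj z))) _ = _
    rw [this]
    exact Fin.snoc_init_self (α := fun _ => UnitAddCircle) _
  let F : Annulus n ≃ₜ Annulus n :=
    { toFun := fun z => (Fin.init (g (proj z)), z.2 + φ (proj z))
      invFun := fun z => (Fin.init (g.symm (proj z)), z.2 - φ (g.symm (proj z)))
      left_inv := fun z => by simp [hproj]
      right_inv := fun z => by simp [hproj']
      continuous_toFun := by
        have := (g.continuous.comp hpc).finInit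
        exact this.prodMk (by fun_prop)
      continuous_invFun := by
        have := (g.symm.continuous.comp hpc).finInit
        exact this.prodMk (by fun_prop) }
  refine ⟨F, fun z => ?_, fun j z => ?_, ?_⟩
  · change L (proj (F z)) = _
    rw [show proj (F z) = g (proj z) from hproj z]
    exact L.apply_symm_apply _
  · have : proj (shift j z) = proj z := proj_eq_proj_iff.2 ⟨j, rfl⟩
    change (_, _) = (_, _)
    simp only [this, shift_snd]
    exact Prod.ext rfl (add_right_comm _ _ _)
  · obtain ⟨K, hK⟩ := isCompact_univ.exists_bound_of_continuousOn hφ.continuousOn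
    exact ⟨K, fun z => by simpa [F] using hK (proj z) (mem_univ _)⟩

end Torus

/-! ### Equivariant height functions -/

namespace Annulus

variable {n : ℕ}

theorem exists_bound_of_apply_shift {H : Annulus n → ℝ} (hH : Continuous H)
    (hs : ∀ (j : ℤ) z, H (shift j z) = H z + j) : ∃ K : ℝ, ∀ z, |H z - z.2| ≤ K := by
  obtain ⟨K, hK⟩ := (isCompact_univ.prod isCompact_Icc :
    IsCompact ((univ : Set (Torus n)) ×ˢ Icc (0 : ℝ) 1)).exists_bound_of_continuousOn
    (f := fun z : Annulus n => H z - z.2) (by fun_prop)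
  refine ⟨K, fun z => ?_⟩
  have h := hK (shift (-⌊z.2⌋) z) ⟨mem_univ _, ?_⟩
  · rw [hs, shift_snd, Real.norm_eq_abs, add_sub_add_right_eq_sub] at h
    exact h
  · rw [shift_snd, Int.cast_neg, ← sub_eq_add_neg, Int.self_sub_floor]
    exact ⟨Int.fract_nonneg _, (Int.fract_lt_one _).le⟩

/-- A height function that turns `F` into the translation by `ρ`, and integer translations of the
annulus into integer translations of the line. -/
structure IsEquivariantHeight (F : Annulus n ≃ₜ Annulus n) (ρ : ℝ) (H : Annulus n → ℝ) : Prop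
    extends IsHeight H where
  apply_map : ∀ z, H (F z) = H z + ρ
  apply_shift : ∀ (j : ℤ) z, H (shift j z) = H z + j

/-- The region below the upper component of `{s < H}`: the part of the complement of the
closure of that component that is unbounded below. -/
def lowerRegion (H : Annulus n → ℝ) (s : ℝ) : Set (Annulus n) :=
  lower (closure (upper {z | H z ≤ s}))

section LowerRegion

variable {H : Annulus n → ℝ} {K : ℝ}

theorem bddAbove_sublevel (hK : ∀ z, |H z - z.2| ≤ K) (s : ℝ) :
    BddAbove (Prod.snd '' {z | H z ≤ s}) := by
  refine ⟨s + K, ?_⟩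
  rintro _ ⟨z, hz, rfl⟩
  linarith [(abs_le.1 (hK z)).1, hz.out]

theorem closure_upper_sublevel_subset (hH : Continuous H) (s : ℝ) :
    closure (upper {z | H z ≤ s}) ⊆ {z | s ≤ H z} :=
  (isClosed_le continuous_const hH).closure_subset_iff.2 fun z hz => by
    have hz' : ¬ H z ≤ s := hz.1
    exact (not_le.1 hz').le

theorem bddBelow_closure_upper_sublevel (hH : Continuous H) (hK : ∀ z, |H z - z.2| ≤ K) (s : ℝ) :
    BddBelow (Prod.snd '' closure (upper {z | H z ≤ s})) := by
  refine ⟨s - K, ?_⟩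
  rintro _ ⟨z, hz, rfl⟩
  linarith [(abs_le.1 (hK z)).2, (closure_upper_sublevel_subset hH s hz).out]

theorem isConnected_closure_upper_sublevel (hK : ∀ z, |H z - z.2| ≤ K) (s : ℝ) :
    IsConnected (closure (upper {z | H z ≤ s})) :=
  ⟨(upper_nonempty (bddAbove_sublevel hK s)).closure,
    (isPreconnected_upper (bddAbove_sublevel hK s)).closure⟩

theorem closure_upper_sublevel_subset_upper (hH : Continuous H) (hK : ∀ z, |H z - z.2| ≤ K)
    {r s : ℝ} (hrs : r < s) : closure (upper {z | H z ≤ s}) ⊆ upper {z | H z ≤ r} := by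
  refine (isConnected_closure_upper_sublevel hK s).2.subset_upper_of_not_bddAbove
    (fun z hz hzr => ?_) fun hb => ?_
  · exact absurd (closure_upper_sublevel_subset hH s hz) (not_le.2 (hzr.out.trans_lt hrs))
  · exact not_bddAbove_upper (bddAbove_sublevel hK s) (hb.mono (image_mono subset_closure))

theorem isNestedFamily_lowerRegion (hH : Continuous H) (hK : ∀ z, |H z - z.2| ≤ K) :
    IsNestedFamily id (lowerRegion H) where
  dense := Function.surjective_id.denseRange
  isOpen s := isOpen_lower isClosed_closure
  closure_subset r s hrs := by
    have hb := bddBelow_closure_upper_sublevel hH hK r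
    refine (isPreconnected_lower hb).closure.subset_lower_of_not_bddBelow (fun z hz hzs => ?_)
      fun hb' => not_bddBelow_lower hb (hb'.mono (image_mono subset_closure))
    -- the open set `upper {H ≤ r}` contains `z` and is disjoint from `lowerRegion H r`
    have hzr := closure_upper_sublevel_subset_upper hH hK hrs hzs
    obtain ⟨w, hw, hw'⟩ := mem_closure_iff.1 hz _
      (isOpen_upper (isClosed_le hH continuous_const)) hzr
    exact hw'.1 (subset_closure hw)
  exists_mem z := ⟨z.2 + K + 1, mem_lower_of_lt (M := z.2 + 1) (fun w hw => by
    linarith [(abs_le.1 (hK w)).2, (closure_upper_sublevel_subset hH _ hw).out])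
    (lt_add_one _)⟩
  exists_notMem z := ⟨z.2 - K - 1, fun hz => hz.1 (subset_closure (mem_upper_of_lt
    (M := z.2 - 1) (fun w hw => by linarith [(abs_le.1 (hK w)).1, hw.out]) (sub_one_lt _)))⟩

theorem image_lowerRegion {F : Annulus n ≃ₜ Annulus n} (hF : F ∈ boundedDisplacement n) {c : ℝ}
    (hFH : ∀ z, H (F z) = H z + c) (s : ℝ) : F '' lowerRegion H s = lowerRegion H (s + c) := by
  have : F '' {z | H z ≤ s} = {z | H z ≤ s + c} := by
    ext z
    obtain ⟨w, rfl⟩ := F.surjective z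
    rw [F.injective.mem_set_image, mem_ofPred_eq, mem_ofPred_eq, hFH, add_le_add_iff_right]
  rw [lowerRegion, image_lower hF, F.image_closure, image_upper hF, this, lowerRegion]

/-- A continuous function that is equivariant can be replaced by an equivariant one with
connected strict sublevel and superlevel sets. -/
theorem exists_isEquivariantHeight {F : Annulus n ≃ₜ Annulus n}
    (hF : F ∈ boundedDisplacement n) {ρ : ℝ} (hH : Continuous H)
    (hFH : ∀ z, H (F z) = H z + ρ) (hs : ∀ (j : ℤ) z, H (shift j z) = H z + j) :
    ∃ H' : Annulus n → ℝ, IsEquivariantHeight F ρ H' := by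
  obtain ⟨K, hK⟩ := exists_bound_of_apply_shift hH hs
  have hN := isNestedFamily_lowerRegion hH hK
  have happ : ∀ G ∈ boundedDisplacement n, ∀ c : ℝ, (∀ z, H (G z) = H z + c) → ∀ z,
      heightFunction id (lowerRegion H) (G z) = heightFunction id (lowerRegion H) z + c :=
    fun G hG c hGH z => hN.heightFunction_apply G (· + c) (add_right_surjective c) c
      (fun _ => rfl) (image_lowerRegion hG hGH) z
  have hshift : ∀ (j : ℤ) z, heightFunction id (lowerRegion H) (shift j z) =
      heightFunction id (lowerRegion H) z + j := fun j =>
    happ (shiftHomeo n j) (shiftHomeo_mem_boundedDisplacement j) j (hs j)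
  refine ⟨heightFunction id (lowerRegion H), ⟨hN.continuous,
    exists_bound_of_apply_shift hN.continuous hshift,
    hN.isPreconnected_lt fun s => isPreconnected_lower (bddBelow_closure_upper_sublevel hH hK s),
    hN.isPreconnected_gt fun s => ?_⟩, happ F hF ρ hFH, hshift⟩
  exact isPreconnected_compl_lower isClosed_closure (bddBelow_closure_upper_sublevel hH hK s)
    (isConnected_closure_upper_sublevel hK s)

end LowerRegion

end Annulus

/-! ### Homotopy classes of maps from the torus to the circle -/

namespace Torus

/-- Every continuous map from the torus to the circle is the sum of a character and of a
null-homotopic map. -/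
theorem exists_eq_sum_zsmul_add {d : ℕ} {h : Torus d → UnitAddCircle} (hh : Continuous h) :
    ∃ (k : Fin d → ℤ) (φ : Torus d → ℝ), Continuous φ ∧
      ∀ y, h y = ∑ i, k i • y i + (φ y : UnitAddCircle) := by
  let e : (Fin d → ℝ) → Torus d := Pi.map fun _ => ((↑) : ℝ → UnitAddCircle)
  have he : IsOpenQuotientMap e :=
    IsOpenQuotientMap.piMap fun _ => QuotientAddGroup.isOpenQuotientMap_mk
  have hec : Continuous e := he.continuous
  have he_int : ∀ (m : Fin d → ℤ) x, e (x + fun i => (m i : ℝ)) = e x := fun m x =>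
    funext fun i => UnitAddCircle.coe_eq_coe_iff.2 ⟨m i, rfl⟩
  obtain ⟨G, hG⟩ := exists_real_lift_of_homotopy (A := Fin d → ℝ)
    ⟨fun p => h (e ((p.1 : ℝ) • p.2)) - h (e 0), by fun_prop⟩ (fun a => by simp)
  let g : (Fin d → ℝ) → ℝ := fun x => G (1, x)
  have hgc : Continuous g := by fun_prop
  have hg : ∀ x, (g x : UnitAddCircle) = h (e x) - h (e 0) := fun x => by simp [g, hG]
  -- the displacement of `g` under an integer translation is an integer constant
  have hgm : ∀ m : Fin d → ℤ, ∀ x, ∃ c : ℤ, g (x + fun i => (m i : ℝ)) - g x = c := by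
    intro m x
    have : (g (x + fun i => (m i : ℝ)) : UnitAddCircle) = g x := by rw [hg, hg, he_int]
    obtain ⟨c, hc⟩ := UnitAddCircle.coe_eq_coe_iff.1 this
    exact ⟨c, by rw [hc]; ring⟩
  choose κ hκ using fun m => hgm m 0
  have hκ' : ∀ m x, g (x + fun i => (m i : ℝ)) - g x = κ m := by
    intro m x
    rw [← hκ m]
    exact isPreconnected_univ.eq_of_intCast (Continuous.continuousOn (by fun_prop))
      (fun x _ => hgm m x) (mem_univ _) (mem_univ _)
  let κh : (Fin d → ℤ) →+ ℤ := AddMonoidHom.mk' κ fun m m' => by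
    have h1 := hκ' (m + m') 0
    have h2 := hκ' m' (0 + fun i => (m i : ℝ))
    have h3 := hκ' m 0
    have h4 : (0 : Fin d → ℝ) + (fun i => ((m + m') i : ℝ)) =
        0 + (fun i => (m i : ℝ)) + fun i => (m' i : ℝ) := by
      funext i; simp
    rw [h4] at h1
    have : (κ (m + m') : ℝ) = κ m + κ m' := by linarith
    exact_mod_cast this
  have hκs : ∀ m, κ m = ∑ i, m i * κ (Pi.single i 1) := by
    intro m
    have h1 : m = ∑ i, m i • Pi.single i (1 : ℤ) := by
      funext j; simp [Finset.sum_apply, Pi.single_apply]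
    have h2 : κh m = ∑ i, m i * κh (Pi.single i 1) := by
      conv_lhs => rw [h1, map_sum]
      simp only [map_zsmul, smul_eq_mul]
    exact h2
  obtain ⟨c₀, hc₀⟩ := QuotientAddGroup.mk_surjective (h (e 0))
  let k : Fin d → ℤ := fun i => κ (Pi.single i 1)
  let ψ : C(Fin d → ℝ, ℝ) := ⟨fun x => g x - ∑ i, k i * x i + c₀, by fun_prop⟩
  have hψ : Function.FactorsThrough ψ e := by
    intro x x' hxx
    choose m hm using fun i => UnitAddCircle.coe_eq_coe_iff.1 (congrFun hxx i)
    obtain rfl : x = x' + fun i => (m i : ℝ) := funext hm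
    have h1 := hκ' m x'
    have h2 : ∑ i, (k i : ℝ) * (x' + fun i => (m i : ℝ)) i = ∑ i, k i * x' i + κ m := by
      rw [hκs m]
      push_cast
      rw [← Finset.sum_add_distrib]
      exact Finset.sum_congr rfl fun i _ => by simp only [Pi.add_apply, k]; ring
    simp only [ψ, ContinuousMap.coe_mk]
    rw [h2]
    linarith
  have hq : IsQuotientMap (⟨e, hec⟩ : C(Fin d → ℝ, Torus d)) := he.isQuotientMap
  refine ⟨k, hq.lift ψ hψ, (hq.lift ψ hψ).continuous, fun y => ?_⟩
  obtain ⟨x, rfl⟩ := he.surjective y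
  have h1 : hq.lift ψ hψ (e x) = ψ x := DFunLike.congr_fun (hq.lift_comp ψ hψ) x
  have h2 : ∑ i, k i • e x i = ((∑ i, k i * x i : ℝ) : UnitAddCircle) := by
    rw [show ((∑ i, k i * x i : ℝ) : UnitAddCircle) =
      ∑ i, ((k i * x i : ℝ) : UnitAddCircle) from map_sum (QuotientAddGroup.mk' _) _ _]
    refine Finset.sum_congr rfl fun i _ => ?_
    rw [← zsmul_eq_mul, AddCircle.coe_zsmul]
    rfl
  have h3 : ((c₀ : ℝ) : UnitAddCircle) = h (e 0) := hc₀
  rw [h1, h2, ← AddCircle.coe_add]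
  simp only [ψ, ContinuousMap.coe_mk]
  rw [show ∑ i, (k i : ℝ) * x i + (g x - ∑ i, k i * x i + c₀) = g x + c₀ by ring,
    AddCircle.coe_add, hg, h3]
  abel

/-- An integer matrix acts on the torus. -/
def matrixAction {d : ℕ} (M : Matrix (Fin d) (Fin d) ℤ) (y : Torus d) : Torus d :=
  fun i => ∑ j, M i j • y j

theorem continuous_matrixAction {d : ℕ} (M : Matrix (Fin d) (Fin d) ℤ) :
    Continuous (matrixAction M) := by
  unfold matrixAction
  fun_prop

theorem matrixAction_mul {d : ℕ} (M N : Matrix (Fin d) (Fin d) ℤ) (y : Torus d) :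
    matrixAction M (matrixAction N y) = matrixAction (M * N) y := by
  funext i
  simp only [matrixAction, Matrix.mul_apply, Finset.sum_smul, Finset.smul_sum, mul_smul]
  exact Finset.sum_comm

theorem matrixAction_one {d : ℕ} (y : Torus d) : matrixAction 1 y = y := by
  funext i
  simp [matrixAction, Matrix.one_apply]

/-- The automorphism of the torus induced by an invertible integer matrix. -/
def matrixEquiv {d : ℕ} (M N : Matrix (Fin d) (Fin d) ℤ) (hMN : M * N = 1) (hNM : N * M = 1) :
    Torus d ≃ₜ+ Torus d where
  toFun := matrixAction M
  invFun := matrixAction N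
  left_inv y := by rw [matrixAction_mul, hNM, matrixAction_one]
  right_inv y := by rw [matrixAction_mul, hMN, matrixAction_one]
  map_add' x y := by
    funext i
    simp [matrixAction, Finset.sum_add_distrib]
  continuous_toFun := continuous_matrixAction M
  continuous_invFun := continuous_matrixAction N

/-- A generator `m` of the range of `κ` need not be `1`: a preimage of `m` together with a basis of
the kernel of `κ` is a basis. -/
theorem exists_basis_apply_eq_zero {n : ℕ} (κ : (Fin (n + 1) → ℤ) →ₗ[ℤ] ℤ) (hκ : κ ≠ 0) :
    ∃ (m : ℤ) (b : Module.Basis (Fin (n + 1)) ℤ (Fin (n + 1) → ℤ)), m ≠ 0 ∧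
      κ (b (Fin.last n)) = m ∧ ∀ i, i ≠ Fin.last n → κ (b i) = 0 := by
  obtain ⟨m, hm⟩ := IsPrincipalIdealRing.principal (LinearMap.range κ)
  have hmem : ∀ x, κ x ∈ LinearMap.range κ ↔ m ∣ κ x := fun x => by
    rw [hm]; exact Ideal.mem_span_singleton
  obtain ⟨v, hv⟩ : m ∈ LinearMap.range κ := by
    rw [hm]; exact Submodule.mem_span_singleton_self m
  have hdvd : ∀ x, m ∣ κ x := fun x => (hmem x).1 ⟨x, rfl⟩
  have hm0 : m ≠ 0 := by
    rintro rfl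
    exact hκ (LinearMap.ext fun x => zero_dvd_iff.1 (hdvd x))
  obtain ⟨n', bk⟩ := Submodule.basisOfPid (Pi.basisFun ℤ (Fin (n + 1))) (LinearMap.ker κ)
  have hli : ∀ (c : ℤ), ∀ x ∈ LinearMap.ker κ, c • v + x = 0 → c = 0 := by
    intro c x hx hcx
    have := congrArg κ hcx
    rw [map_add, map_smul, hv, LinearMap.mem_ker.1 hx, add_zero, map_zero, smul_eq_mul] at this
    exact (mul_eq_zero.1 this).resolve_right hm0
  have hsp : ∀ z, ∃ c : ℤ, z + c • v ∈ LinearMap.ker κ := by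
    intro z
    obtain ⟨c, hc⟩ := hdvd z
    refine ⟨-c, ?_⟩
    rw [LinearMap.mem_ker, map_add, map_smul, hv, hc, smul_eq_mul]
    ring
  let b := Module.Basis.mkFinCons v bk hli hsp
  have hnn : n' = n := by
    have := Fintype.card_congr (b.indexEquiv (Pi.basisFun ℤ (Fin (n + 1))))
    simpa using this
  subst hnn
  refine ⟨m, b.reindex Fin.revPerm, hm0, ?_, fun i hi => ?_⟩
  · simp [b, hv]
  · obtain ⟨j, hj⟩ := Fin.exists_succ_eq.2 (show Fin.rev i ≠ 0 from fun h => hi (by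
      rw [← Fin.rev_rev i, h, Fin.rev_zero]))
    simp [b, ← hj]

/-- Every nontrivial character of the torus becomes a multiple of the last coordinate after an
automorphism. -/
theorem exists_automorphism {n : ℕ} {k : Fin (n + 1) → ℤ} (hk : k ≠ 0) :
    ∃ (m : ℤ) (L : Torus (n + 1) ≃ₜ+ Torus (n + 1)), m ≠ 0 ∧
      ∀ y, ∑ i, k i • L y i = m • y (Fin.last n) := by
  let κ : (Fin (n + 1) → ℤ) →ₗ[ℤ] ℤ := ∑ i, k i • LinearMap.proj i
  have hκ : ∀ x, κ x = ∑ i, k i * x i := fun x => by simp [κ, LinearMap.sum_apply]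
  obtain ⟨m, b, hm, hb, hb0⟩ := exists_basis_apply_eq_zero κ fun h0 => hk <| funext fun i => by
    have := hκ (Pi.single i 1)
    simpa [h0, Pi.single_apply] using this.symm
  let s := Pi.basisFun ℤ (Fin (n + 1))
  refine ⟨m, matrixEquiv (s.toMatrix b) (b.toMatrix s) (s.toMatrix_mul_toMatrix_flip b)
    (b.toMatrix_mul_toMatrix_flip s), hm, fun y => ?_⟩
  have h1 : ∀ j, ∑ i, k i * s.toMatrix b i j = κ (b j) := fun j => by
    rw [hκ]; simp [s, Module.Basis.toMatrix_apply]
  calc ∑ i, k i • ∑ j, s.toMatrix b i j • y j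
      = ∑ j, (∑ i, k i * s.toMatrix b i j) • y j := by
        simp only [Finset.smul_sum, Finset.sum_smul, mul_smul]
        exact Finset.sum_comm
    _ = m • y (Fin.last n) := by
        simp only [h1]
        rw [Finset.sum_eq_single (Fin.last n) (fun j _ hj => by rw [hb0 j hj, zero_smul])
          (by simp), hb]

/-! ### From a semiconjugacy to an equivariant height function -/

/-- A semiconjugacy to an irrational rotation is not null-homotopic: a real lift would be
increased by a nonzero constant at its extrema. -/
theorem exists_isEquivariantHeight_of_isSemiconjugacy {n : ℕ} {f : Torus (n + 1) ≃ₜ Torus (n + 1)}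
    (hf : ContinuousMap.Homotopic (f : C(Torus (n + 1), Torus (n + 1)))
      (ContinuousMap.id (Torus (n + 1)))) {ρ : ℝ} (hρ : Irrational ρ)
    {h : Torus (n + 1) → UnitAddCircle} (hh : IsSemiconjugacy f ρ h) :
    ∃ (L : Torus (n + 1) ≃ₜ+ Torus (n + 1)) (F : Annulus n ≃ₜ Annulus n) (ρ' : ℝ)
      (H : Annulus n → ℝ), IsAnnularLift L f F ∧ Irrational ρ' ∧
        Annulus.IsEquivariantHeight F ρ' H := by
  obtain ⟨k, φ, hφ, hk⟩ := exists_eq_sum_zsmul_add hh.1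
  have hk0 : k ≠ 0 := by
    rintro rfl
    have h1 : ∀ y, ∃ m : ℤ, φ (f y) - φ y - ρ = m := fun y => by
      have := hh.2.2 y
      rw [hk, hk] at this
      simp only [Pi.zero_apply, zero_smul, Finset.sum_const_zero, zero_add] at this
      rw [← AddCircle.coe_add] at this
      obtain ⟨m, hm⟩ := UnitAddCircle.coe_eq_coe_iff.1 this
      exact ⟨m, by rw [hm]; ring⟩
    have h2 : ∀ y y', φ (f y) - φ y - ρ = φ (f y') - φ y' - ρ := fun y y' =>
      isPreconnected_univ.eq_of_intCast (Continuous.continuousOn (by fun_prop))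
        (fun x _ => h1 x) (mem_univ _) (mem_univ _)
    obtain ⟨ymax, -, hmax⟩ := isCompact_univ.exists_isMaxOn univ_nonempty hφ.continuousOn
    obtain ⟨ymin, -, hmin⟩ := isCompact_univ.exists_isMinOn univ_nonempty hφ.continuousOn
    obtain ⟨m, hm⟩ := h1 ymax
    have h3 := hmax (mem_univ (f ymax))
    have h4 := hmin (mem_univ (f ymin))
    have h5 := h2 ymax ymin
    simp only [mem_ofPred_eq] at h3 h4
    exact hρ.ne_int (-m) (by push_cast; linarith)
  obtain ⟨m, L, hm, hL⟩ := exists_automorphism hk0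
  obtain ⟨F, hF⟩ := exists_isAnnularLift f hf L
  have hm' : (m : ℝ) ≠ 0 := Int.cast_ne_zero.2 hm
  have hcov : Continuous (cover (n := n) L) := (isOpenQuotientMap_cover L).continuous
  let H : Annulus n → ℝ := fun z => z.2 + φ (cover L z) / m
  have hHc : Continuous H := by fun_prop
  have hH : ∀ z, h (cover L z) = ((m * H z : ℝ) : UnitAddCircle) := by
    intro z
    rw [hk, cover, hL, Annulus.last_proj, ← AddCircle.coe_zsmul, ← AddCircle.coe_add,
      zsmul_eq_mul]
    congr 1
    simp only [H]
    field_simp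
    rfl
  have h1 : ∀ z, ∃ j : ℤ, m * H (F z) - m * H z - ρ = j := fun z => by
    have := hh.2.2 (cover L z)
    rw [← hF.cover_apply, hH, hH, ← AddCircle.coe_add] at this
    obtain ⟨j, hj⟩ := UnitAddCircle.coe_eq_coe_iff.1 this
    exact ⟨j, by rw [hj]; ring⟩
  obtain ⟨j, hj⟩ := h1 0
  have h2 : ∀ z, m * H (F z) - m * H z - ρ = j := fun z => by
    rw [← hj]
    exact isPreconnected_univ.eq_of_intCast (Continuous.continuousOn (by fun_prop))
      (fun x _ => h1 x) (mem_univ _) (mem_univ _)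
  obtain ⟨H', hH'⟩ := Annulus.exists_isEquivariantHeight hF.mem_boundedDisplacement
    (ρ := (ρ + j) / m) hHc (fun z => by
      have := h2 z
      field_simp
      linarith) (fun i z => by simp only [H, cover_shift, Annulus.shift_snd]; ring)
  exact ⟨L, F, _, H', hF, (hρ.add_intCast j).div_intCast hm, hH'⟩

end Torus

/-! ### The circular order of the circle -/

theorem UnitAddCircle.sbtw_coe_iff {a b c : ℝ} :
    sbtw (a : UnitAddCircle) b c ↔ ∃ i j : ℤ, a < b + i ∧ b + i < c + j ∧ c + j < a + 1 := by
  rw [sbtw_iff_not_btw]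
  change ¬ btw ((c : ℝ) : ℝ ⧸ AddSubgroup.zmultiples (1 : ℝ)) b a ↔ _
  rw [QuotientAddGroup.btw_coe_iff, not_le]
  constructor
  · intro h
    obtain ⟨hA, i, hi⟩ := (toIocMod_eq_iff (one_pos (α := ℝ)) (a := c) (b := a)).1 rfl
    obtain ⟨hB, j, hj⟩ := (toIcoMod_eq_iff (one_pos (α := ℝ)) (a := c) (b := b)).1 rfl
    rw [zsmul_one] at hi hj
    refine ⟨i - j, i + 1, ?_, ?_, ?_⟩ <;> push_cast <;> linarith [hA.1, hB.2]
  · rintro ⟨i, j, h1, h2, h3⟩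
    rw [(toIocMod_eq_iff (c := a - (j - 1)) Fact.out).2
        ⟨⟨by linarith, by linarith⟩, j - 1, by push_cast [zsmul_one]; ring⟩,
      (toIcoMod_eq_iff (c := b + i - (j - 1)) Fact.out).2
        ⟨⟨by linarith, by linarith⟩, j - 1 - i, by push_cast [zsmul_one]; ring⟩]
    linarith

/-- The multiples of a point of the circle are not circularly ordered like `0 < 1 < 2 < ⋯`. -/
theorem UnitAddCircle.not_forall_sbtw (α : ℝ) : ¬ ∀ m l : ℕ, 0 < m → m < l →
    sbtw ((0 : ℝ) : UnitAddCircle) ((m * α : ℝ) : UnitAddCircle) ((l * α : ℝ) : UnitAddCircle) := by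
  intro h
  have hfr : ∀ (x y : ℝ) (i : ℤ), x + i = y → 0 < y → y < 1 → Int.fract x = y := by
    intro x y i hxy h0 h1
    rw [← Int.fract_add_intCast x i, hxy, Int.fract_eq_self.2 ⟨h0.le, h1⟩]
  have key : ∀ m l : ℕ, 0 < m → m < l →
      0 < Int.fract (m * α) ∧ Int.fract (m * α) < Int.fract (l * α) := by
    intro m l hm hml
    obtain ⟨i, j, h1, h2, h3⟩ := UnitAddCircle.sbtw_coe_iff.1 (h m l hm hml)
    rw [hfr _ _ i rfl h1 (by linarith), hfr _ _ j rfl (by linarith) (by linarith)]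
    exact ⟨h1, h2⟩
  have hα : 0 < Int.fract α := by simpa using (key 1 2 one_pos one_lt_two).1
  have hlin : ∀ m : ℕ, m * Int.fract α ≤ Int.fract (m * α) := by
    intro m
    induction m with
    | zero => simp
    | succ m ih =>
      rcases Nat.eq_zero_or_pos m with rfl | hm
      · simp
      obtain ⟨z, hz⟩ := Int.fract_add (m * α) α
      have hlt := (key m (m + 1) hm (Nat.lt_succ_self m)).2
      push_cast at hlt ⊢
      rw [add_mul, one_mul] at hlt
      rw [add_mul, one_mul, add_mul, one_mul]
      have hz1 : (-1 : ℝ) < z := by rw [← hz]; linarith [Int.fract_lt_one α]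
      have hz0 : (0 : ℝ) ≤ z := by
        have : (-1 : ℤ) < z := by exact_mod_cast hz1
        exact_mod_cast (by omega : (0 : ℤ) ≤ z)
      linarith
  obtain ⟨m, hm⟩ := exists_nat_gt (1 / Int.fract α)
  rw [div_lt_iff₀ hα] at hm
  linarith [hlin m, Int.fract_lt_one (m * α)]

/-! ### Lifts of continua -/

theorem IsCompact.exists_isClosed_isClosed_diff {α : Type*} [TopologicalSpace α] [T2Space α]
    {K O : Set α} (hK : IsCompact K) (hO : IsOpen O) {z : α} (hz : z ∈ K)
    (h : connectedComponentIn K z ⊆ O) :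
    ∃ V ⊆ K, IsClosed V ∧ IsClosed (K \ V) ∧ z ∈ V ∧ V ⊆ O := by
  have := isCompact_iff_compactSpace.1 hK
  have : Nonempty {s : Set K // IsClopen s ∧ (⟨z, hz⟩ : K) ∈ s} := ⟨⟨univ, isClopen_univ, trivial⟩⟩
  obtain ⟨⟨s, hs, hzs⟩, hsO⟩ := exists_subset_nhds_of_compactSpace
    (V := fun s : {s : Set K // IsClopen s ∧ (⟨z, hz⟩ : K) ∈ s} => s.1)
    (fun s t => ⟨⟨s.1 ∩ t.1, s.2.1.inter t.2.1, s.2.2, t.2.2⟩, inter_subset_left,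
      inter_subset_right⟩) (fun s => s.2.1.1) (U := (↑) ⁻¹' O) (fun x hx => by
        rw [← connectedComponent_eq_iInter_isClopen] at hx
        refine (hO.preimage continuous_subtype_val).mem_nhds (h ?_)
        rw [connectedComponentIn_eq_image hz]
        exact mem_image_of_mem _ hx)
  refine ⟨(↑) '' s, Subtype.coe_image_subset K s, ?_, ?_, ⟨_, hzs, rfl⟩, image_subset_iff.2 hsO⟩
  · exact hK.isClosed.isClosedEmbedding_subtypeVal.isClosedMap _ hs.1
  · convert hK.isClosed.isClosedEmbedding_subtypeVal.isClosedMap _ hs.compl.1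
    ext x
    simp only [mem_sdiff, mem_image, Subtype.exists, exists_and_right, exists_eq_right,
      mem_compl_iff]
    exact ⟨fun ⟨hx, hn⟩ => ⟨hx, fun hxs => hn ⟨hx, hxs⟩⟩,
      fun ⟨hx, hn⟩ => ⟨hx, fun ⟨_, hxs⟩ => hn hxs⟩⟩

namespace Torus

open Annulus

variable {n : ℕ} {L : Torus (n + 1) ≃ₜ+ Torus (n + 1)}

/-- A compact lift of a continuum projects onto the continuum: it has arbitrarily small compact
neighbourhoods that are open and closed in the preimage, and these project onto open and closed
subsets of the continuum. -/
theorem IsLift.image_cover {A : Set (Torus (n + 1))} {A' : Set (Annulus n)} (h : IsLift L A A')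
    (hA : IsClosed A) (hc : IsPreconnected A) (hA' : IsCompact A') : cover L '' A' = A := by
  obtain ⟨z, hz, rfl⟩ := h
  have hcov := (isOpenQuotientMap_cover (n := n) L)
  have hsubP := connectedComponentIn_subset (cover L ⁻¹' A) z
  refine (image_subset_iff.2 hsubP).antisymm fun a ha => ?_
  by_contra hno
  obtain ⟨M, hM⟩ := (hA'.image continuous_snd).isBounded.exists_pos_norm_lt.imp fun _ h => h.2
  have hM' : ∀ w ∈ connectedComponentIn (cover L ⁻¹' A) z, |w.2| < M := fun w hw =>
    hM _ ⟨w, hw, rfl⟩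
  have hPc : IsClosed (cover L ⁻¹' A) := hA.preimage hcov.continuous
  set K := cover L ⁻¹' A ∩ {w : Annulus n | |w.2| ≤ M} with hKdef
  have hslab : IsCompact {w : Annulus n | |w.2| ≤ M} := by
    convert (isCompact_univ (X := Torus n)).prod (isCompact_Icc (a := -M) (b := M)) using 1
    ext w
    simp [abs_le]
  have hK : IsCompact K := hslab.inter_left hPc
  have hzc := mem_connectedComponentIn hz
  have hzK : z ∈ K := ⟨hz, (hM' z hzc).le⟩
  have hcomp : connectedComponentIn K z = connectedComponentIn (cover L ⁻¹' A) z :=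
    (connectedComponentIn_mono z inter_subset_left).antisymm
      (isPreconnected_connectedComponentIn.subset_connectedComponentIn hzc
        fun w hw => ⟨hsubP hw, (hM' w hw).le⟩)
  obtain ⟨V, hVK, hV, hKV, hzV, hVO⟩ := hK.exists_isClosed_isClosed_diff
    (O := {w : Annulus n | |w.2| < M} ∩ (cover L ⁻¹' {a})ᶜ)
    ((isOpen_lt (by fun_prop) continuous_const).inter
      (isClosed_singleton.preimage hcov.continuous).isOpen_compl) hzK (by
        rw [hcomp]
        exact fun w hw => ⟨hM' w hw, fun hwa => hno ⟨w, hw, hwa⟩⟩)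
  have hPV : IsClosed (cover L ⁻¹' A \ V) := by
    have : cover L ⁻¹' A \ V = (K \ V) ∪ (cover L ⁻¹' A ∩ {w : Annulus n | M ≤ |w.2|}) := by
      ext w
      constructor
      · rintro ⟨hw, hwV⟩
        exact (le_total |w.2| M).imp (fun h => ⟨⟨hw, h⟩, hwV⟩) (fun h => ⟨hw, h⟩)
      · rintro (⟨hw, hwV⟩ | ⟨hw, hwM⟩)
        · exact ⟨hw.1, hwV⟩
        · exact ⟨hw, fun hwV => (hVO hwV).1.out.not_ge hwM⟩
    rw [this]
    exact hKV.union (hPc.inter (isClosed_le continuous_const (by fun_prop)))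
  have hopen : IsOpen (cover L '' (cover L ⁻¹' A \ V)ᶜ) :=
    hcov.isOpenMap _ hPV.isOpen_compl
  have hclosed : IsClosed (cover L '' V) :=
    ((hK.of_isClosed_subset hV hVK).image hcov.continuous).isClosed
  have hmem : ∀ b ∈ A, b ∈ cover L '' (cover L ⁻¹' A \ V)ᶜ → b ∈ cover L '' V := by
    rintro b hb ⟨w, hw, rfl⟩
    exact ⟨w, by_contra fun hwV => hw ⟨hb, hwV⟩, rfl⟩
  obtain ⟨b, hbA, hb, hbV⟩ := hc _ _ hopen hclosed.isOpen_compl (fun b hb => by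
      by_cases hbV : b ∈ cover L '' V
      · obtain ⟨w, hw, rfl⟩ := hbV
        exact Or.inl ⟨w, fun h => h.2 hw, rfl⟩
      · exact Or.inr hbV)
    ⟨_, hz, z, fun h => h.2 hzV, rfl⟩ ⟨a, ha, fun ⟨w, hwV, hwa⟩ => (hVO hwV).2 hwa⟩
  exact hbV (hmem b hbA hb)

end Torus

/-! ### Ordered groups of rank two -/

theorem nsmul_of_forall_add {P : ℤ × ℤ → Prop} (hadd : ∀ u v, P u → P v → P (u + v)) {v : ℤ × ℤ}
    (hv : P v) {m : ℕ} (hm : 0 < m) : P (m • v) := by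
  induction m, hm using Nat.le_induction with
  | base => exact (one_nsmul v).symm ▸ hv
  | succ m _ ih => rw [succ_nsmul]; exact hadd _ _ ih hv

/-- The positive cone of a translation-invariant total order on `ℤ × ℤ` in which the multiples of
`(0, 1)` are cofinal contains an open half-plane bounded by a line through the origin. -/
theorem exists_slope {P : ℤ × ℤ → Prop} (hadd : ∀ u v, P u → P v → P (u + v))
    (htot : ∀ v, v ≠ 0 → P v ∨ P (-v)) (hasymm : ∀ v, P v → ¬ P (-v)) (hpos : P (0, 1))
    (harch : ∀ k : ℤ, ∃ N : ℤ, P (k, N)) :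
    ∃ ρ : ℝ, ∀ k j : ℤ, 0 < k * ρ + j → P (k, j) := by
  have hzsmul : ∀ v, P v → ∀ m : ℤ, 0 < m → P (m • v) := by
    intro v hv m hm
    lift m to ℕ using hm.le
    rw [natCast_zsmul]
    exact nsmul_of_forall_add hadd hv (by exact_mod_cast hm)
  have hzero : ¬ P 0 := fun h => hasymm 0 h (by rwa [neg_zero])
  have hvert : ∀ j : ℤ, P (0, j) ↔ 0 < j := by
    intro j
    have hj : ∀ i : ℤ, 0 < i → P (0, i) := fun i hi => by
      simpa using hzsmul _ hpos i hi
    refine ⟨fun h => ?_, hj j⟩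
    by_contra hle
    rcases (not_lt.1 hle).eq_or_lt with rfl | hlt
    · exact hzero h
    · exact hasymm _ h (by simpa using hj (-j) (by omega))
  have hdiv : ∀ v, ∀ m : ℤ, 0 < m → P (m • v) → P v := by
    intro v m hm h
    have hv : v ≠ 0 := by
      rintro rfl
      exact hzero (by simpa using h)
    refine (htot v hv).resolve_right fun hn => ?_
    have := hzsmul _ hn m hm
    rw [smul_neg] at this
    exact hasymm _ h this
  let S : Set ℝ := {x | ∃ p q : ℤ, 0 < q ∧ P (q, -p) ∧ x = p / q}
  have hne : S.Nonempty := by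
    obtain ⟨N, hN⟩ := harch 1
    exact ⟨_, -N, 1, one_pos, by rwa [neg_neg], rfl⟩
  have hbdd : BddAbove S := by
    obtain ⟨N, hN⟩ := harch (-1)
    refine ⟨N, ?_⟩
    rintro _ ⟨p, q, hq, hpq, rfl⟩
    have h1 := hadd _ _ hpq (hzsmul _ hN q hq)
    have h2 : (q, -p) + q • ((-1 : ℤ), N) = (0, q * N - p) := by
      ext <;> simp [sub_eq_neg_add]
    rw [h2, hvert] at h1
    rw [div_le_iff₀ (by exact_mod_cast hq)]
    have : (p : ℝ) < q * N := by exact_mod_cast (by omega : p < q * N)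
    linarith
  refine ⟨sSup S, fun k j hkj => ?_⟩
  rcases lt_trichotomy k 0 with hk | rfl | hk
  · have hk' : (0 : ℝ) < -k := by exact_mod_cast (by omega : 0 < -k)
    refine (htot (k, j) (fun h => hk.ne (congrArg Prod.fst h))).resolve_right fun hn => ?_
    have hmem : ((j : ℝ) / (-k : ℤ)) ∈ S := ⟨j, -k, by omega, hn, rfl⟩
    have := le_csSup hbdd hmem
    push_cast at this
    rw [div_le_iff₀ hk'] at this
    linarith
  · rw [hvert]
    simpa using hkj
  · have hk' : (0 : ℝ) < k := by exact_mod_cast hk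
    have hlt : -(j : ℝ) / k < sSup S := by
      rw [div_lt_iff₀ hk']
      linarith
    obtain ⟨_, ⟨p, q, hq, hpq, rfl⟩, hx⟩ := exists_lt_of_lt_csSup hne hlt
    have hq' : (0 : ℝ) < q := by exact_mod_cast hq
    rw [div_lt_div_iff₀ hk' hq'] at hx
    have hx' : 0 < k * p + j * q := by
      have : (0 : ℝ) < k * p + j * q := by linarith
      exact_mod_cast this
    refine hdiv (k, j) q hq ?_
    have h1 := hadd _ _ (hzsmul _ hpq k hk) ((hvert _).2 hx')
    convert h1 using 1
    ext
    · simp [mul_comm]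
    · simp only [Prod.smul_snd, Prod.snd_add, smul_eq_mul]; ring

namespace Torus

open Annulus

variable {n : ℕ} {L : Torus (n + 1) ≃ₜ+ Torus (n + 1)} {f : Torus (n + 1) ≃ₜ Torus (n + 1)}
  {F : Annulus n ≃ₜ Annulus n}

/-! ### The group generated by a lift and the integer translations -/

namespace IsAnnularLift

theorem one : IsAnnularLift (n := n) L 1 1 := ⟨fun _ => rfl, fun _ _ => rfl, one_mem _⟩

theorem mul {g : Torus (n + 1) ≃ₜ Torus (n + 1)} {G : Annulus n ≃ₜ Annulus n}
    (hF : IsAnnularLift L f F) (hG : IsAnnularLift L g G) : IsAnnularLift L (f * g) (F * G) where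
  cover_apply z := by simp [hF.cover_apply, hG.cover_apply]
  apply_shift j z := by simp [hF.apply_shift, hG.apply_shift]
  mem_boundedDisplacement := mul_mem hF.mem_boundedDisplacement hG.mem_boundedDisplacement

theorem inv (hF : IsAnnularLift L f F) : IsAnnularLift L f⁻¹ F⁻¹ where
  cover_apply z := by
    apply f.injective
    rw [← hF.cover_apply]
    exact (congrArg (cover L) (F.apply_symm_apply z)).trans (f.apply_symm_apply _).symm
  apply_shift j z := by
    apply F.injective
    rw [hF.apply_shift]
    exact (F.apply_symm_apply _).trans (congrArg (shift j) (F.apply_symm_apply z).symm)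
  mem_boundedDisplacement := inv_mem hF.mem_boundedDisplacement

theorem zpow (hF : IsAnnularLift L f F) (k : ℤ) : IsAnnularLift L (f ^ k) (F ^ k) := by
  induction k using Int.induction_on with
  | zero => simpa using one
  | succ i ih => rw [zpow_add_one, zpow_add_one]; exact ih.mul hF
  | pred i ih => rw [zpow_sub_one, zpow_sub_one]; exact ih.mul hF.inv

end IsAnnularLift

/-- The element of the group generated by `F` and the unit translation with exponents
`v = (k, j)`: the map `z ↦ F^k(z) + (0, j)`. -/
def latticeMap (F : Annulus n ≃ₜ Annulus n) (v : ℤ × ℤ) : Annulus n ≃ₜ Annulus n :=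
  shiftHomeo n v.2 * F ^ v.1

theorem latticeMap_apply (F : Annulus n ≃ₜ Annulus n) (v : ℤ × ℤ) (z : Annulus n) :
    latticeMap F v z = shift v.2 ((F ^ v.1) z) := rfl

namespace IsAnnularLift

theorem latticeMap_add (hF : IsAnnularLift L f F) (u v : ℤ × ℤ) (z : Annulus n) :
    latticeMap F (u + v) z = latticeMap F u (latticeMap F v z) := by
  simp only [latticeMap_apply, Prod.fst_add, Prod.snd_add, (hF.zpow u.1).apply_shift, shift_shift,
    zpow_add]
  rfl

theorem latticeMap_mem (hF : IsAnnularLift L f F) (v : ℤ × ℤ) :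
    latticeMap F v ∈ boundedDisplacement n :=
  mul_mem (shiftHomeo_mem_boundedDisplacement _) (hF.zpow _).mem_boundedDisplacement

theorem cover_latticeMap (hF : IsAnnularLift L f F) (v : ℤ × ℤ) (z : Annulus n) :
    cover L (latticeMap F v z) = (f ^ v.1) (cover L z) := by
  rw [latticeMap_apply, cover_shift, (hF.zpow _).cover_apply]

theorem image_latticeMap_add (hF : IsAnnularLift L f F) (u v : ℤ × ℤ) (A : Set (Annulus n)) :
    latticeMap F (u + v) '' A = latticeMap F u '' (latticeMap F v '' A) := by
  rw [image_image]
  exact image_congr fun z _ => hF.latticeMap_add u v z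

theorem cover_image_latticeMap (hF : IsAnnularLift L f F) (v : ℤ × ℤ) (A : Set (Annulus n)) :
    cover L '' (latticeMap F v '' A) = (f ^ v.1) '' (cover L '' A) := by
  rw [image_image, image_image]
  exact image_congr fun z _ => hF.cover_latticeMap v z

theorem isLift_latticeMap (hF : IsAnnularLift L f F) {A : Set (Torus (n + 1))}
    {A' : Set (Annulus n)} (h : IsLift L A A') (v : ℤ × ℤ) :
    IsLift L ((f ^ v.1) '' A) (latticeMap F v '' A') := by
  obtain ⟨z, hz, rfl⟩ := h
  have hP : latticeMap F v '' (cover L ⁻¹' A) = cover L ⁻¹' ((f ^ v.1) '' A) := by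
    ext w
    obtain ⟨w, rfl⟩ := (latticeMap F v).surjective w
    rw [(latticeMap F v).injective.mem_set_image, mem_preimage, mem_preimage,
      hF.cover_latticeMap, (f ^ v.1).injective.mem_set_image]
  refine ⟨latticeMap F v z, ?_, ?_⟩
  · rw [← hP]; exact mem_image_of_mem _ hz
  · rw [← hP, Homeomorph.image_connectedComponentIn _ hz]

end IsAnnularLift

theorem latticeMap_zero_image (F : Annulus n ≃ₜ Annulus n) (A : Set (Annulus n)) :
    latticeMap F 0 '' A = A := by
  rw [show ⇑(latticeMap F 0) = id from funext fun z => by rw [latticeMap_apply]; simp, image_id]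

theorem latticeMap_vertical_image (F : Annulus n ≃ₜ Annulus n) (j : ℤ) (A : Set (Annulus n)) :
    latticeMap F (0, j) '' A = shift j '' A := by
  refine image_congr fun z _ => ?_
  rw [latticeMap_apply]
  simp

/-! ### Criterion for the circular order -/

theorem image_shift_image_shift (i j : ℤ) (A : Set (Annulus n)) :
    shift i '' (shift j '' A) = shift (i + j) '' A := by
  rw [image_image]
  exact image_congr fun z _ => shift_shift i j z

/-- The hypothesis `hup` makes the lifts `B₁` and `B₃` adjacent: the translates of `B₁` and `B₃` by
`j > 0` are above `B₃`, and hence those by `j < 0` are below `B₁`. -/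
theorem strictlyBetween_of_precedes {A₁ A₃ : Set (Torus (n + 1))} {B₁ B₂ B₃ : Set (Annulus n)}
    (h₁ : IsLift L A₁ B₁) (h₃ : IsLift L A₃ B₃) (e₁ : Annulus.IsEssentialContinuum B₁)
    (e₂ : Annulus.IsEssentialContinuum B₂) (e₃ : Annulus.IsEssentialContinuum B₃)
    (h₁₂ : Precedes B₁ B₂) (h₂₃ : Precedes B₂ B₃)
    (hup : ∀ j : ℤ, 0 < j → Precedes B₃ (shift j '' B₁)) :
    StrictlyBetween L A₁ (cover L '' B₂) A₃ := by
  have h₁₃ : Precedes B₁ B₃ := h₁₂.trans h₂₃ e₁ e₂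
  have es₁ : ∀ j, Annulus.IsEssentialContinuum (shift j '' B₁) := fun j =>
    e₁.image (shiftHomeo_mem_boundedDisplacement j)
  have es₃ : ∀ j, Annulus.IsEssentialContinuum (shift j '' B₃) := fun j =>
    e₃.image (shiftHomeo_mem_boundedDisplacement j)
  have hs₁₃ : ∀ j, Precedes (shift j '' B₁) (shift j '' B₃) := fun j =>
    h₁₃.image (shiftHomeo_mem_boundedDisplacement j)
  -- continua above `B₃` and continua below `B₁` are not contained in the closed interval
  have hout : ∀ {C}, Annulus.IsEssentialContinuum C → Precedes B₃ C ∨ Precedes C B₁ →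
      ¬ C ⊆ closedInterval B₁ B₃ := by
    intro C hC h hCsub
    obtain ⟨c, hc⟩ := hC.2.1.1
    exact hCsub hc (h.symm.imp (fun h => h.subset_lower hC hc) (fun h => h hc))
  refine ⟨B₁, B₃, h₁, h₃, ⟨h₁₃, fun j hj => ?_⟩, image_mono fun z hz =>
    ⟨h₁₂ hz, h₂₃.subset_lower e₂ hz⟩⟩
  rcases lt_or_gt_of_ne hj with hneg | hpos
  · have h := (hup (-j) (by omega)).image (shiftHomeo_mem_boundedDisplacement j)
    simp only [coe_shiftHomeo] at h
    rw [image_shift_image_shift, add_neg_cancel, show shift 0 '' B₁ = B₁ by simp] at h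
    exact ⟨hout (es₁ j) (Or.inr ((hs₁₃ j).trans h (es₁ j) (es₃ j))), hout (es₃ j) (Or.inr h)⟩
  · have h := hup j hpos
    exact ⟨hout (es₁ j) (Or.inl h), hout (es₃ j) (Or.inl (h.trans (hs₁₃ j) e₃ (es₁ j)))⟩

/-! ### From irrational combinatorics to an equivariant height function -/

section Family

variable {E : Set (Torus (n + 1))} {E' : Set (Annulus n)}

/-- A translation that maps a point of a compact lift into the lift preserves the lift, because it
permutes the components of the preimage; this contradicts compactness unless it is trivial. -/
theorem IsLift.eq_zero_of_mem (h : IsLift L E E') (hE' : IsCompact E') {a : Annulus n}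
    (ha : a ∈ E') {m : ℤ} (hm : shift m a ∈ E') : m = 0 := by
  obtain ⟨z, hz, rfl⟩ := h
  have hP : ∀ w ∈ connectedComponentIn (cover L ⁻¹' E) z,
      shift m w ∈ connectedComponentIn (cover L ⁻¹' E) z := by
    intro w hw
    have h1 : IsPreconnected (shiftHomeo n m '' connectedComponentIn (cover L ⁻¹' E) z) :=
      isPreconnected_connectedComponentIn.image _ (shiftHomeo n m).continuous.continuousOn
    rw [connectedComponentIn_eq hm]
    refine h1.subset_connectedComponentIn ⟨a, ha, rfl⟩ ?_ ⟨w, hw, rfl⟩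
    rintro _ ⟨v, hv, rfl⟩
    rw [mem_preimage, coe_shiftHomeo, cover_shift]
    exact connectedComponentIn_subset (cover L ⁻¹' E) _ hv
  obtain ⟨b, hb, hmax⟩ := hE'.exists_isMaxOn ⟨a, ha⟩ continuous_snd.continuousOn
  obtain ⟨c, hc, hmin⟩ := hE'.exists_isMinOn ⟨a, ha⟩ continuous_snd.continuousOn
  have h1 := hmax (hP b hb)
  have h2 := hmin (hP c hc)
  simp only [mem_ofPred_eq, shift_snd] at h1 h2
  have h3 : (m : ℝ) ≤ 0 := by linarith
  have h4 : (0 : ℝ) ≤ m := by linarith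
  exact_mod_cast le_antisymm h3 h4

theorem IsAnnularLift.disjoint_latticeMap (hF : IsAnnularLift L f F) (h : IsLift L E E')
    (hE' : IsCompact E') (hdis : ∀ k m : ℤ, k ≠ m → Disjoint ((f ^ k) '' E) ((f ^ m) '' E))
    {u v : ℤ × ℤ} (huv : u ≠ v) : Disjoint (latticeMap F u '' E') (latticeMap F v '' E') := by
  have hsub : ∀ a ∈ E', cover L a ∈ E := by
    obtain ⟨z, hz, rfl⟩ := h
    exact fun a ha => connectedComponentIn_subset (cover L ⁻¹' E) _ ha
  rw [disjoint_left]
  rintro _ ⟨a, ha, rfl⟩ ⟨b, hb, hab⟩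
  have h1 : u.1 = v.1 := by
    by_contra hne
    refine (disjoint_left.1 (hdis _ _ hne)) (mem_image_of_mem _ (hsub a ha)) ?_
    rw [← hF.cover_latticeMap, ← hab, hF.cover_latticeMap]
    exact mem_image_of_mem _ (hsub b hb)
  have h2 : b = shift (u.2 - v.2) a := by
    apply (F ^ v.1).injective
    rw [(hF.zpow _).apply_shift]
    have := congrArg (shift (-v.2)) hab
    rw [latticeMap_apply, latticeMap_apply, shift_shift, shift_shift, h1, neg_add_cancel,
      shift_zero] at this
    rw [this, neg_add_eq_sub]
  have h3 := h.eq_zero_of_mem hE' ha (h2 ▸ hb)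
  exact huv (Prod.ext h1 (by omega))

/-- The lifts of the continua `f^k(E)` are totally ordered, and the order is invariant under the
lattice generated by `F` and the unit translation. The irrational circular order excludes that the
slope of this order is rational, as the iterates along a rational slope would be ordered like the
integers. Hence the slope `ρ` is irrational, and the regions below the lifts form a nested family
with the dense set of values `kρ + j`. -/
theorem exists_isEquivariantHeight_of_hasIrrationalCombinatorics
    (hf : ContinuousMap.Homotopic (f : C(Torus (n + 1), Torus (n + 1)))
      (ContinuousMap.id (Torus (n + 1)))) (hE : IsCompact E) (hEc : IsConnected E)
    (h : HasIrrationalCombinatorics (fun k : ℤ => ⇑(f ^ k) '' E)) :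
    ∃ (L : Torus (n + 1) ≃ₜ+ Torus (n + 1)) (F : Annulus n ≃ₜ Annulus n) (ρ : ℝ)
      (H : Annulus n → ℝ), IsAnnularLift L f F ∧ Irrational ρ ∧
        Annulus.IsEquivariantHeight F ρ H := by
  obtain ⟨hdis, L, hess, α, -, hα⟩ := h
  obtain ⟨-, -, E', hE'l, hE'e⟩ := hess 0
  simp only [zpow_zero] at hE'l
  rw [show ((1 : Torus (n + 1) ≃ₜ Torus (n + 1)) '' E) = E from image_id E] at hE'l
  obtain ⟨F, hF⟩ := exists_isAnnularLift f hf L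
  have hcov : cover L '' E' = E := hE'l.image_cover hE.isClosed hEc.2 hE'e.1
  -- the family of all lifts and its order
  let T : ℤ × ℤ → Set (Annulus n) := fun v => latticeMap F v '' E'
  have hTe : ∀ v, Annulus.IsEssentialContinuum (T v) := fun v => hE'e.image (hF.latticeMap_mem v)
  have hT0 : T 0 = E' := latticeMap_zero_image F E'
  have hTadd : ∀ u v, T (u + v) = latticeMap F u '' T v := fun u v =>
    hF.image_latticeMap_add u v E'
  have hTj : ∀ j : ℤ, T (0, j) = shift j '' E' := fun j => latticeMap_vertical_image F j E'
  have hTlift : ∀ v, IsLift L (⇑(f ^ v.1) '' E) (T v) := fun v => hF.isLift_latticeMap hE'l v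
  have htrans : ∀ u v w, Precedes (T u) (T v) → Precedes (T (w + u)) (T (w + v)) := by
    intro u v w huv
    rw [hTadd, hTadd]
    exact huv.image (hF.latticeMap_mem w)
  obtain ⟨Mu, hMu⟩ := hE'e.1.bddAbove_snd
  obtain ⟨Ml, hMl⟩ := hE'e.1.bddBelow_snd
  have hhigh : ∀ z : Annulus n, ∀ j : ℤ, Mu < z.2 + j → z ∈ upper (T (0, -j)) := by
    intro z j hj
    refine mem_upper_of_lt (M := Mu - j) ?_ (by linarith)
    rw [hTj]
    rintro _ ⟨w, hw, rfl⟩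
    have := hMu ⟨w, hw, rfl⟩
    rw [shift_snd]
    push_cast
    linarith
  have hlow : ∀ z : Annulus n, ∀ j : ℤ, z.2 < Ml + j → z ∈ lower (T (0, j)) := by
    intro z j hj
    refine mem_lower_of_lt (M := Ml + j) ?_ hj
    rw [hTj]
    rintro _ ⟨w, hw, rfl⟩
    have := hMl ⟨w, hw, rfl⟩
    rw [shift_snd]
    linarith
  let P : ℤ × ℤ → Prop := fun v => Precedes (T 0) (T v)
  have hPsub : ∀ u v, P (v - u) → Precedes (T u) (T v) := by
    intro u v huv
    have := htrans _ _ u huv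
    rwa [add_zero, add_sub_cancel] at this
  have hadd : ∀ u v, P u → P v → P (u + v) := by
    intro u v hu hv
    have := htrans _ _ u hv
    rw [add_zero] at this
    exact Precedes.trans hu this (hTe _) (hTe _)
  have hneg : ∀ v, Precedes (T v) (T 0) ↔ P (-v) := by
    intro v
    refine ⟨fun hv => ?_, fun hv => hPsub _ _ (by rwa [zero_sub])⟩
    have := htrans _ _ (-v) hv
    rwa [neg_add_cancel, add_zero] at this
  have htot : ∀ v, v ≠ 0 → P v ∨ P (-v) := by
    intro v hv
    rw [← hneg]
    exact (hTe 0).precedes_or_precedes (hTe v)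
      (hF.disjoint_latticeMap hE'l hE'e.1 hdis hv.symm)
  have hasymm : ∀ v, P v → ¬ P (-v) := by
    intro v hv hnv
    exact Precedes.not_precedes hv (hTe _) (hTe _) ((hneg v).2 hnv)
  have harch : ∀ k : ℤ, ∃ N : ℤ, ∀ j, N ≤ j → P (k, j) := by
    intro k
    obtain ⟨m, hm⟩ := (hTe (k, 0)).1.bddBelow_snd
    obtain ⟨N, hN⟩ := exists_int_gt (Mu - m)
    refine ⟨N, fun j hj => ?_⟩
    have h1 : Precedes (T (0, -j)) (T (k, 0)) := fun z hz => hhigh z j (by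
      have h2 := hm ⟨z, hz, rfl⟩
      have h3 : (N : ℝ) ≤ j := by exact_mod_cast hj
      linarith)
    have := htrans _ _ (0, j) h1
    simp only [Prod.mk_add_mk, add_neg_cancel, add_zero, zero_add] at this
    exact this
  have hpos : P (0, 1) := by
    refine (htot _ (by simp)).resolve_right fun hn => ?_
    -- otherwise all downward translates of `E'` would be above `E'`
    have hall : ∀ m : ℕ, P (0, -(m + 1 : ℤ)) := by
      intro m
      induction m with
      | zero => simpa using hn
      | succ m ih => simpa [add_comm, add_left_comm] using hadd _ _ ih hn
    obtain ⟨N, hN⟩ := harch 0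
    exact hasymm _ (hN (N.toNat + 1) (by omega)) (by simpa using hall N.toNat)
  obtain ⟨ρ, hρ⟩ := exists_slope hadd htot hasymm hpos fun k =>
    (harch k).imp fun N hN => hN N le_rfl
  have hρ' : ∀ v : ℤ × ℤ, 0 < v.1 * ρ + v.2 → P v := fun v => hρ v.1 v.2
  have hirr : Irrational ρ := by
    rintro ⟨q, rfl⟩
    have hq : ((q.den : ℤ) : ℝ) * (q : ℝ) + ((-q.num : ℤ) : ℝ) = 0 := by
      have : (q.den : ℝ) * (q : ℝ) = q.num := by exact_mod_cast Rat.den_mul_eq_num q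
      push_cast
      linarith
    obtain ⟨w, hPw, hw⟩ : ∃ w, P w ∧ w.1 * (q : ℝ) + w.2 = 0 := by
      rcases htot ((q.den : ℤ), -q.num) (fun h => by simpa using congrArg Prod.fst h) with h | h
      · exact ⟨_, h, hq⟩
      · refine ⟨_, h, ?_⟩
        simp only [Prod.fst_neg, Prod.snd_neg]
        push_cast at hq ⊢
        linarith
    have hPm : ∀ m : ℕ, 0 < m → P (m • w) := fun m hm => nsmul_of_forall_add hadd hPw hm
    refine UnitAddCircle.not_forall_sbtw (w.1 * α) fun m l hm hml => ?_
    have hsb := (hα 0 (0 * w.1) (m * w.1) (l * w.1)).1 ?_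
    · convert hsb using 2
      · simp
      · rw [zero_add]; push_cast; ring_nf
      · rw [zero_add]; push_cast; ring_nf
    · have e2 : (fun k : ℤ => ⇑(f ^ k) '' E) (m * w.1) = cover L '' T (m • w) := by
        change _ = cover L '' (latticeMap F (m • w) '' E')
        rw [hF.cover_image_latticeMap, hcov]
        simp
      rw [e2]
      refine strictlyBetween_of_precedes (B₁ := T 0) (B₃ := T (l • w)) ?_ ?_ (hTe _) (hTe _)
        (hTe _) (hPm m hm) (hPsub _ _ ?_) fun j hj => ?_
      · simpa using hTlift 0
      · simpa using hTlift (l • w)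
      · rw [sub_eq_add_neg, ← sub_nsmul w hml.le]
        exact hPm _ (by omega)
      · rw [hT0, ← hTj]
        have h1 : ((((0, j) - l • w : ℤ × ℤ).1 : ℤ) : ℝ) * q + (((0, j) - l • w : ℤ × ℤ).2 : ℤ) =
            j - l * (w.1 * q + w.2) := by
          simp
          ring
        have h2 : P ((0, j) - l • w) := by
          apply hρ'
          rw [h1, hw, mul_zero, sub_zero]
          exact_mod_cast hj
        exact hPsub (l • w) (0, j) h2
  -- the nested family of the regions below the lifts
  let val : ℤ × ℤ → ℝ := fun v => v.1 * ρ + v.2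
  have hprec : ∀ u v, val u < val v → Precedes (T u) (T v) := fun u v huv =>
    hPsub u v (hρ' (v - u) (by
      simp only [val] at huv
      push_cast [Prod.fst_sub, Prod.snd_sub]
      linarith))
  have hN : IsNestedFamily val (fun v => lower (T v)) :=
    { dense := by
        have h1 : Dense (AddSubgroup.closure {ρ, 1} : Set ℝ) :=
          dense_addSubgroupClosure_pair_iff.2 (by simpa using hirr)
        refine h1.mono fun x hx => ?_
        obtain ⟨m, k, hmk⟩ := AddSubgroup.mem_closure_pair.1 hx
        exact ⟨(m, k), by simpa [val] using hmk⟩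
      isOpen := fun v => isOpen_lower (hTe v).1.isClosed
      closure_subset := fun u v huv =>
        (closure_lower_subset (hTe u).1.isClosed (hTe u).1.bddBelow_snd).trans
          ((hTe u).lower_union_subset (hprec u v huv))
      exists_mem := fun z => by
        obtain ⟨j, hj⟩ := exists_int_gt (z.2 - Ml)
        exact ⟨(0, j), hlow z j (by linarith)⟩
      exists_notMem := fun z => by
        obtain ⟨j, hj⟩ := exists_int_gt (Mu - z.2)
        exact ⟨(0, -j), fun hz => (hTe _).disjoint.notMem_of_mem_left
          (hhigh z j (by linarith)) hz⟩ }
  have happ : ∀ (w : ℤ × ℤ) z, heightFunction val (fun v => lower (T v)) (latticeMap F w z) =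
      heightFunction val (fun v => lower (T v)) z + val w := fun w z =>
    hN.heightFunction_apply (latticeMap F w) (w + ·) (add_left_surjective w) (val w)
      (fun v => by simp only [val, Prod.fst_add, Prod.snd_add]; push_cast; ring)
      (fun v => by rw [image_lower (hF.latticeMap_mem w), hTadd]) z
  have hshift : ∀ (j : ℤ) z, heightFunction val (fun v => lower (T v)) (shift j z) =
      heightFunction val (fun v => lower (T v)) z + j := fun j z => by
    have := happ (0, j) z
    simpa [latticeMap_apply, val] using this
  refine ⟨L, F, ρ, heightFunction val (fun v => lower (T v)), hF, hirr,
    ⟨hN.continuous, exists_bound_of_apply_shift hN.continuous hshift,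
      hN.isPreconnected_lt fun v => isPreconnected_lower (hTe v).1.bddBelow_snd,
      hN.isPreconnected_gt fun v => isPreconnected_compl_lower (hTe v).1.isClosed
        (hTe v).1.bddBelow_snd (hTe v).2.1⟩, fun z => ?_, hshift⟩
  have := happ (1, 0) z
  simpa [latticeMap_apply, val] using this

end Family

end Torus

/-! ### Circloids -/

namespace Annulus

variable {n : ℕ}

theorem isEssentialAnnularContinuum_sInter {c : Set (Set (Annulus n))} (hchain : IsChain (· ⊆ ·) c)
    (hne : c.Nonempty) (hc : ∀ A ∈ c, IsEssentialAnnularContinuum A) :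
    IsEssentialAnnularContinuum (⋂₀ c) := by
  have : Nonempty c := hne.to_subtype
  obtain ⟨A₀, hA₀⟩ := hne
  have hcomp : ∀ A ∈ c, IsCompact A := fun A hA => (hc A hA).1.1
  have hdir : Directed (· ⊇ ·) (fun A : c => (A : Set (Annulus n))) := fun A B =>
    (hchain.total A.2 B.2).elim (fun h => ⟨A, subset_rfl, h⟩) (fun h => ⟨B, h, subset_rfl⟩)
  have hI : IsCompact (⋂₀ c) := (hcomp A₀ hA₀).of_isClosed_subset
    (isClosed_sInter fun A hA => (hcomp A hA).isClosed) (sInter_subset_of_mem hA₀)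
  have hconn : IsConnected (⋂₀ c) := by
    rw [sInter_eq_iInter]
    exact ⟨IsCompact.nonempty_iInter_of_directed_nonempty_isCompact_isClosed _ hdir
      (fun A => (hc A A.2).1.2.1.1) (fun A => hcomp A A.2) (fun A => (hcomp A A.2).isClosed),
      IsPreconnected.iInter_of_directed hdir (fun A => hcomp A A.2)
        (fun A => (hc A A.2).1.2.1.2)⟩
  have hupper : ∀ A ∈ c, upper A ⊆ upper (⋂₀ c) := fun A hA => upper_anti (sInter_subset_of_mem hA)
  have hlower : ∀ A ∈ c, lower A ⊆ lower (⋂₀ c) := fun A hA => lower_anti (sInter_subset_of_mem hA)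
  have hcover : (⋂₀ c)ᶜ ⊆ (⋃ A ∈ c, upper A) ∪ ⋃ A ∈ c, lower A := by
    intro z hz
    simp only [mem_compl_iff, mem_sInter, not_forall] at hz
    obtain ⟨A, hA, hzA⟩ := hz
    have : z ∈ upper A ∪ lower A := (hc A hA).2 ▸ hzA
    exact this.imp (fun h => mem_biUnion hA h) (fun h => mem_biUnion hA h)
  have hdisj : Disjoint (⋃ A ∈ c, upper A) (⋃ A ∈ c, lower A) := by
    simp only [disjoint_iUnion_left, disjoint_iUnion_right]
    intro B hB A hA
    rcases hchain.total hA hB with h | h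
    · exact (hc A hA).1.disjoint.mono_right (lower_anti h)
    · exact (hc B hB).1.disjoint.mono_left (upper_anti h)
  refine ⟨isEssentialContinuum_iff.2 ⟨hI, hconn, ?_⟩, Subset.antisymm (hcover.trans
    (union_subset_union (iUnion₂_subset hupper) (iUnion₂_subset hlower)))
    (union_subset upper_subset_compl lower_subset_compl)⟩
  -- `upper (⋂₀ c)` is connected, hence contained in the union of the sets `upper A`
  have hU : upper (⋂₀ c) ⊆ ⋃ A ∈ c, upper A := by
    obtain ⟨z, hz⟩ := upper_nonempty (hcomp A₀ hA₀).bddAbove_snd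
    exact (isPreconnected_upper hI.bddAbove_snd).subset_left_of_subset_union
      (isOpen_biUnion fun A hA => isOpen_upper (hcomp A hA).isClosed)
      (isOpen_biUnion fun A hA => isOpen_lower (hcomp A hA).isClosed) hdisj
      (upper_subset_compl.trans hcover) ⟨z, hupper A₀ hA₀ hz, mem_biUnion hA₀ hz⟩
  have hL : lower (⋂₀ c) ⊆ ⋃ A ∈ c, lower A := by
    obtain ⟨z, hz⟩ := lower_nonempty (hcomp A₀ hA₀).bddBelow_snd
    exact (isPreconnected_lower hI.bddBelow_snd).subset_right_of_subset_union
      (isOpen_biUnion fun A hA => isOpen_upper (hcomp A hA).isClosed)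
      (isOpen_biUnion fun A hA => isOpen_lower (hcomp A hA).isClosed) hdisj
      (lower_subset_compl.trans hcover) ⟨z, hlower A₀ hA₀ hz, mem_biUnion hA₀ hz⟩
  exact hdisj.mono hU hL

theorem IsEssentialAnnularContinuum.exists_isEssentialCircloid_subset {A : Set (Annulus n)}
    (hA : IsEssentialAnnularContinuum A) : ∃ C ⊆ A, IsEssentialCircloid C := by
  obtain ⟨C, hCA, hC⟩ := zorn_superset_nonempty {B | IsEssentialAnnularContinuum B}
    (fun c hc hchain hne => ⟨⋂₀ c, isEssentialAnnularContinuum_sInter hchain hne hc,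
      fun _ hs => sInter_subset_of_mem hs⟩) A hA
  exact ⟨C, hCA, hC.prop, fun B hBC hB => hBC.antisymm (hC.le_of_le hB hBC)⟩

/-! ### The level sets of a height function are annular continua -/

namespace IsHeight

variable {H : Annulus n → ℝ}

theorem not_bddAbove_gt (hH : IsHeight H) (s : ℝ) : ¬ BddAbove (Prod.snd '' {z | s < H z}) := by
  obtain ⟨K, hK⟩ := hH.bdd
  rw [not_bddAbove_iff]
  intro x
  refine ⟨max x (s + K) + 1, ⟨(0, max x (s + K) + 1), ?_, rfl⟩, by linarith [le_max_left x (s + K)]⟩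
  have := (abs_le.1 (hK (0, max x (s + K) + 1))).1
  rw [mem_ofPred_eq]
  dsimp only at this
  linarith [le_max_right x (s + K)]

theorem not_bddBelow_lt (hH : IsHeight H) (s : ℝ) : ¬ BddBelow (Prod.snd '' {z | H z < s}) := by
  obtain ⟨K, hK⟩ := hH.bdd
  rw [not_bddBelow_iff]
  intro x
  refine ⟨min x (s - K) - 1, ⟨(0, min x (s - K) - 1), ?_, rfl⟩, by linarith [min_le_left x (s - K)]⟩
  have := (abs_le.1 (hK (0, min x (s - K) - 1))).2
  rw [mem_ofPred_eq]
  dsimp only at this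
  linarith [min_le_right x (s - K)]

theorem gt_subset_upper (hH : IsHeight H) {s : ℝ} {A : Set (Annulus n)} (hA : ∀ z ∈ A, H z = s) :
    {z | s < H z} ⊆ upper A :=
  (hH.isPreconnected_gt s).subset_upper_of_not_bddAbove
    (fun _ hz hzA => hz.out.ne' (hA _ hzA)) (hH.not_bddAbove_gt s)

theorem lt_subset_lower (hH : IsHeight H) {s : ℝ} {A : Set (Annulus n)} (hA : ∀ z ∈ A, H z = s) :
    {z | H z < s} ⊆ lower A :=
  (hH.isPreconnected_lt s).subset_lower_of_not_bddBelow
    (fun _ hz hzA => hz.out.ne (hA _ hzA)) (hH.not_bddBelow_lt s)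

theorem isEssentialAnnularContinuum_level (hH : IsHeight H) (s : ℝ) :
    IsEssentialAnnularContinuum {z | H z = s} := by
  have hgt : {z | s < H z} ⊆ upper {z | H z = s} := hH.gt_subset_upper fun _ h => h
  have hlt : {z | H z < s} ⊆ lower {z | H z = s} := hH.lt_subset_lower fun _ h => h
  have hcover : {z | H z = s}ᶜ ⊆ {z | H z < s} ∪ {z | s < H z} := fun z hz => lt_or_gt_of_ne hz
  have hdisj : Disjoint {z | H z < s} {z | s < H z} :=
    disjoint_left.2 fun z hz hz' => lt_asymm hz.out hz'.out
  have ho₁ : IsOpen {z | H z < s} := isOpen_lt hH.continuous continuous_const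
  have ho₂ : IsOpen {z | s < H z} := isOpen_lt continuous_const hH.continuous
  have hcpt := hH.isCompact_level s
  have hU : upper {z | H z = s} ⊆ {z | s < H z} := by
    obtain ⟨z, hz⟩ : {z | s < H z}.Nonempty :=
      (nonempty_of_not_bddAbove (hH.not_bddAbove_gt s)).of_image
    exact (isPreconnected_upper hcpt.bddAbove_snd).subset_right_of_subset_union ho₁ ho₂ hdisj
      (upper_subset_compl.trans hcover) ⟨z, hgt hz, hz⟩
  have hL : lower {z | H z = s} ⊆ {z | H z < s} := by
    obtain ⟨z, hz⟩ : {z | H z < s}.Nonempty :=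
      (nonempty_of_not_bddBelow (hH.not_bddBelow_lt s)).of_image
    exact (isPreconnected_lower hcpt.bddBelow_snd).subset_left_of_subset_union ho₁ ho₂ hdisj
      (lower_subset_compl.trans hcover) ⟨z, hlt hz, hz⟩
  refine ⟨isEssentialContinuum_iff.2 ⟨hcpt, hH.isConnected_level s, hdisj.symm.mono hU hL⟩,
    Subset.antisymm ?_ (union_subset upper_subset_compl lower_subset_compl)⟩
  exact hcover.trans (union_subset (hlt.trans subset_union_right) (hgt.trans subset_union_left))

end IsHeight

end Annulus

namespace Torus

open Annulus

variable {n : ℕ} {L : Torus (n + 1) ≃ₜ+ Torus (n + 1)} {f : Torus (n + 1) ≃ₜ Torus (n + 1)}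
  {F : Annulus n ≃ₜ Annulus n} {ρ s : ℝ} {H : Annulus n → ℝ}

/-! ### The semiconjugacy induced by an equivariant height function -/

/-- `H` takes values in a discrete set on the preimage of `cover L '' A`, so that its lifts are
the integer translates of `A`. -/
theorem isLift_image_cover_iff (hH : Annulus.IsEquivariantHeight F ρ H) {A B : Set (Annulus n)}
    (hA : ∀ z ∈ A, H z = s) (hc : IsConnected A) :
    IsLift L (cover L '' A) B ↔ ∃ j : ℤ, B = shift j '' A := by
  have hP : ∀ w ∈ cover L ⁻¹' (cover L '' A), ∃ j : ℤ, w ∈ shift j '' A := by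
    rintro w ⟨a, ha, haw⟩
    obtain ⟨j, rfl⟩ := cover_eq_cover_iff.1 haw.symm
    exact ⟨j, a, ha, rfl⟩
  have hsub : ∀ j : ℤ, shift j '' A ⊆ cover L ⁻¹' (cover L '' A) := by
    rintro j _ ⟨a, ha, rfl⟩
    exact ⟨a, ha, (cover_shift L j a).symm⟩
  have hval : ∀ (j : ℤ), ∀ w ∈ shift j '' A, H w = s + j := by
    rintro j _ ⟨a, ha, rfl⟩
    rw [hH.apply_shift, hA a ha]
  have hcomp : ∀ (j : ℤ), ∀ w ∈ shift j '' A,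
      connectedComponentIn (cover L ⁻¹' (cover L '' A)) w = shift j '' A := by
    intro j w hw
    apply Subset.antisymm
    · intro v hv
      have h1 : H w - s = H v - s := isPreconnected_connectedComponentIn.eq_of_intCast
        (f := fun z => H z - s) (hH.continuous.sub continuous_const).continuousOn (fun z hz => by
          obtain ⟨i, hi⟩ := hP z (connectedComponentIn_subset _ _ hz)
          exact ⟨i, by rw [hval i z hi]; ring⟩) (mem_connectedComponentIn (hsub j hw)) hv
      obtain ⟨i, hi⟩ := hP v (connectedComponentIn_subset _ _ hv)
      rw [hval j w hw, hval i v hi] at h1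
      have : j = i := by exact_mod_cast (by linarith : (j : ℝ) = i)
      rwa [this]
    · exact (hc.2.image _ (shiftHomeo n j).continuous.continuousOn).subset_connectedComponentIn hw
        (hsub j)
  constructor
  · rintro ⟨z, hz, rfl⟩
    obtain ⟨j, hj⟩ := hP z hz
    exact ⟨j, hcomp j z hj⟩
  · rintro ⟨j, rfl⟩
    obtain ⟨a, ha⟩ := hc.1
    exact ⟨shift j a, hsub j ⟨a, ha, rfl⟩, (hcomp j _ ⟨a, ha, rfl⟩).symm⟩

theorem isLift_image_cover (hH : Annulus.IsEquivariantHeight F ρ H) {A : Set (Annulus n)}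
    (hA : ∀ z ∈ A, H z = s) (hc : IsConnected A) : IsLift L (cover L '' A) A :=
  (isLift_image_cover_iff hH hA hc).2 ⟨0, by simp⟩

theorem exists_isSemiconjugacy (hF : IsAnnularLift L f F)
    (hH : Annulus.IsEquivariantHeight F ρ H) :
    ∃ h : Torus (n + 1) → UnitAddCircle, IsSemiconjugacy f ρ h ∧
      ∀ ξ : UnitAddCircle, Torus.IsEssentialAnnularContinuum (h ⁻¹' {ξ}) := by
  have hcov := isOpenQuotientMap_cover (n := n) L
  have hq : IsQuotientMap (⟨cover L, hcov.continuous⟩ : C(Annulus n, Torus (n + 1))) :=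
    hcov.isQuotientMap
  let g : C(Annulus n, UnitAddCircle) := ⟨fun z => (H z : UnitAddCircle),
    (AddCircle.continuous_mk' 1).comp hH.continuous⟩
  have hg : Function.FactorsThrough g (cover L) := by
    intro z w hzw
    obtain ⟨j, rfl⟩ := cover_eq_cover_iff.1 hzw
    exact UnitAddCircle.coe_eq_coe_iff.2 ⟨j, hH.apply_shift j w⟩
  let h := hq.lift g hg
  have hh : ∀ z, h (cover L z) = (H z : UnitAddCircle) := DFunLike.congr_fun (hq.lift_comp g hg)
  obtain ⟨K, hK⟩ := hH.bdd
  refine ⟨h, ⟨h.continuous, fun ξ => ?_, fun y => ?_⟩, fun ξ => ?_⟩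
  · obtain ⟨s, rfl⟩ := QuotientAddGroup.mk_surjective ξ
    obtain ⟨z, rfl⟩ := surjective_of_bdd hH.continuous hK s
    exact ⟨cover L z, hh z⟩
  · obtain ⟨z, rfl⟩ := hcov.surjective y
    rw [← hF.cover_apply, hh, hh, hH.apply_map, AddCircle.coe_add]
  · obtain ⟨s, rfl⟩ := QuotientAddGroup.mk_surjective ξ
    have hfib : h ⁻¹' {QuotientAddGroup.mk s} = cover L '' {z | H z = s} := by
      ext y
      obtain ⟨z, rfl⟩ := hcov.surjective y
      rw [mem_preimage, mem_singleton_iff, hh]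
      constructor
      · intro hz
        obtain ⟨m, hm⟩ := UnitAddCircle.coe_eq_coe_iff.1 hz
        refine ⟨shift (-m) z, ?_, cover_shift L _ z⟩
        rw [mem_ofPred_eq, hH.apply_shift, hm]
        push_cast
        ring
      · rintro ⟨w, hw, hwz⟩
        rw [← hh, ← hwz, hh, hw.out]
    rw [hfib]
    exact ⟨(hH.isCompact_level s).image hcov.continuous,
      (hH.isConnected_level s).image _ hcov.continuous.continuousOn, L, _,
      isLift_image_cover hH (fun _ hz => hz) (hH.isConnected_level s),
      hH.isEssentialAnnularContinuum_level s⟩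

/-! ### Irrational combinatorics of continua contained in level sets -/

theorem apply_zpow (hH : Annulus.IsEquivariantHeight F ρ H) (k : ℤ) (z : Annulus n) :
    H ((F ^ k) z) = H z + k * ρ := by
  induction k using Int.induction_on generalizing z with
  | zero => simp
  | succ i ih =>
    rw [zpow_add_one, show (F ^ (i : ℤ) * F) z = (F ^ (i : ℤ)) (F z) from rfl, ih, hH.apply_map]
    push_cast
    ring
  | pred i ih =>
    have h1 : H ((F⁻¹ : Annulus n ≃ₜ Annulus n) z) = H z - ρ := by
      rw [eq_sub_iff_add_eq, ← hH.apply_map]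
      exact congrArg H (F.apply_symm_apply z)
    rw [zpow_sub_one, show (F ^ (-i : ℤ) * F⁻¹) z = (F ^ (-i : ℤ)) (F⁻¹ z) from rfl, ih, h1]
    push_cast
    ring

theorem apply_latticeMap (hH : Annulus.IsEquivariantHeight F ρ H) (v : ℤ × ℤ) (z : Annulus n) :
    H (latticeMap F v z) = H z + (v.1 * ρ + v.2) := by
  rw [latticeMap_apply, hH.apply_shift, apply_zpow hH, add_assoc]

theorem _root_.Irrational.eq_of_mul_add_eq (hρ : Irrational ρ) {u v : ℤ × ℤ}
    (h : u.1 * ρ + u.2 = v.1 * ρ + v.2) : u = v := by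
  have h1 : u.1 = v.1 := by
    by_contra hne
    have hne' : u.1 - v.1 ≠ 0 := sub_ne_zero.2 hne
    apply (hρ.intCast_mul hne').ne_int (v.2 - u.2)
    push_cast
    linarith
  rw [h1] at h
  exact Prod.ext h1 (by exact_mod_cast add_left_cancel h)

/-- The lifts of the iterates of `cover L '' A` are the sets `latticeMap F (k, j) '' A`, which lie
in the levels `s + kρ + j` and are ordered like these numbers. -/
theorem hasIrrationalCombinatorics_image_cover (hF : IsAnnularLift L f F) (hρ : Irrational ρ)
    (hH : Annulus.IsEquivariantHeight F ρ H) {A : Set (Annulus n)} (hA : ∀ z ∈ A, H z = s)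
    (hAe : Annulus.IsEssentialContinuum A) :
    HasIrrationalCombinatorics (fun k : ℤ => ⇑(f ^ k) '' (cover L '' A)) := by
  let T : ℤ × ℤ → Set (Annulus n) := fun v => latticeMap F v '' A
  let val : ℤ × ℤ → ℝ := fun v => v.1 * ρ + v.2
  have hTe : ∀ v, Annulus.IsEssentialContinuum (T v) := fun v => hAe.image (hF.latticeMap_mem v)
  have hTH : ∀ v, ∀ z ∈ T v, H z = s + val v := by
    rintro v _ ⟨a, ha, rfl⟩
    rw [apply_latticeMap hH, hA a ha]
  have hTcov : ∀ v, ⇑(f ^ v.1) '' (cover L '' A) = cover L '' T v := fun v =>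
    (hF.cover_image_latticeMap v A).symm
  have hTshift : ∀ (j : ℤ) v, shift j '' T v = T (v.1, v.2 + j) := by
    intro j v
    rw [← latticeMap_vertical_image F, ← hF.image_latticeMap_add]
    have : ((0, j) : ℤ × ℤ) + v = (v.1, v.2 + j) := by ext <;> simp [add_comm]
    rw [this]
  have hprec : ∀ u v, val u < val v → Precedes (T u) (T v) := fun u v huv z hz =>
    hH.gt_subset_upper (hTH u) (by rw [mem_ofPred_eq, hTH v z hz]; linarith)
  have hlift : ∀ (v : ℤ × ℤ) B, IsLift L (⇑(f ^ v.1) '' (cover L '' A)) B ↔ ∃ j : ℤ, B = T (v.1, j) := by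
    intro v B
    rw [hTcov (v.1, 0), isLift_image_cover_iff hH (hTH _) (hTe _).2.1]
    refine exists_congr fun j => ?_
    rw [hTshift, zero_add]
  have hlt_of : ∀ u v z, z ∈ T v → z ∈ upper (T u) → val u < val v := by
    intro u v z hzv hzu
    rcases lt_trichotomy (val u) (val v) with h | h | h
    · exact h
    · exact absurd hzv ((hρ.eq_of_mul_add_eq h) ▸ hzu.1)
    · exact ((hTe u).disjoint.notMem_of_mem_left hzu
        ((hprec v u h).subset_lower (hTe v) hzv)).elim
  have hlt_of' : ∀ u v z, z ∈ T v → z ∈ lower (T u) → val v < val u := by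
    intro u v z hzv hzu
    rcases lt_trichotomy (val v) (val u) with h | h | h
    · exact h
    · exact absurd hzv ((hρ.eq_of_mul_add_eq h) ▸ hzu.1)
    · exact ((hTe u).disjoint.notMem_of_mem_left (hprec u v h hzv) hzu).elim
  refine ⟨fun k m hkm => ?_, L, fun k => ⟨?_, ?_, T (k, 0), ?_, hTe _⟩, ρ, hρ, ?_⟩
  · change Disjoint (⇑(f ^ (k, (0 : ℤ)).1) '' (cover L '' A))
      (⇑(f ^ (m, (0 : ℤ)).1) '' (cover L '' A))
    rw [hTcov, hTcov, disjoint_left]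
    rintro _ ⟨x, hx, rfl⟩ ⟨x', hx', hxx⟩
    obtain ⟨j, rfl⟩ := cover_eq_cover_iff.1 hxx
    have h1 := hTH _ _ hx'
    rw [hH.apply_shift, hTH _ _ hx] at h1
    refine hkm (congrArg Prod.fst (hρ.eq_of_mul_add_eq (u := (k, j)) (v := (m, 0)) ?_))
    simp only [val, Int.cast_zero, add_zero] at h1 ⊢
    linarith
  · exact (hAe.1.image (isOpenQuotientMap_cover L).continuous).image (f ^ k).continuous
  · exact (hAe.2.1.image _ (isOpenQuotientMap_cover L).continuous.continuousOn).image _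
      (f ^ k).continuous.continuousOn
  · exact (hlift (k, 0) _).2 ⟨0, rfl⟩
  intro y₀ k m l
  obtain ⟨r, rfl⟩ := QuotientAddGroup.mk_surjective y₀
  have hsb : sbtw ((r : UnitAddCircle) + ((k * ρ : ℝ) : UnitAddCircle))
      ((r : UnitAddCircle) + ((m * ρ : ℝ) : UnitAddCircle))
      ((r : UnitAddCircle) + ((l * ρ : ℝ) : UnitAddCircle)) ↔
      ∃ i j : ℤ, k * ρ < m * ρ + i ∧ m * ρ + i < l * ρ + j ∧ l * ρ + j < k * ρ + 1 := by
    rw [← AddCircle.coe_add, ← AddCircle.coe_add, ← AddCircle.coe_add,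
      UnitAddCircle.sbtw_coe_iff]
    simp only [add_assoc, add_lt_add_iff_left]
  refine Iff.trans ?_ hsb.symm
  constructor
  · rintro ⟨A₁, A₃, h₁, h₃, ⟨h₁₃, hadj⟩, hmid⟩
    obtain ⟨i, rfl⟩ := (hlift (k, 0) _).1 h₁
    obtain ⟨j, rfl⟩ := (hlift (l, 0) _).1 h₃
    dsimp only at *
    obtain ⟨a, ha⟩ := hAe.2.1.1
    obtain ⟨w, hw, hwa⟩ := hmid (mem_image_of_mem _ (mem_image_of_mem _ ha))
    rw [← hF.cover_latticeMap (m, 0)] at hwa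
    obtain ⟨p, hp⟩ := cover_eq_cover_iff.1 hwa
    have hwT : w ∈ T (m, p) := by
      have : w ∈ shift p '' T (m, 0) := ⟨_, mem_image_of_mem _ ha, hp.symm⟩
      rwa [hTshift, zero_add] at this
    have h1 := hlt_of _ _ _ hwT hw.1
    have h2 := hlt_of' _ _ _ hwT hw.2
    have h3 : val (l, j) < val (k, i) + 1 := by
      by_contra! hle
      -- the translate of the first lift by one would be in the closed interval
      apply (hadj 1 one_ne_zero).1
      rw [hTshift]
      intro z hz hzmem
      have hv : val (k, i + 1) = val (k, i) + 1 := by simp only [val]; push_cast; ring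
      rcases hzmem with hz' | hz'
      · have := hlt_of' _ _ _ hz hz'
        linarith
      · have := hlt_of _ _ _ hz hz'
        linarith
    refine ⟨p - i, j - i, ?_⟩
    simp only [val] at h1 h2 h3
    push_cast
    exact ⟨by linarith, by linarith, by linarith⟩
  · rintro ⟨i, j, h1, h2, h3⟩
    have hm : ⇑(f ^ m) '' (cover L '' A) = cover L '' T (m, i) := hTcov (m, i)
    dsimp only
    rw [hm]
    refine strictlyBetween_of_precedes (B₁ := T (k, 0)) (B₃ := T (l, j))
      ((hlift (k, 0) _).2 ⟨0, rfl⟩) ((hlift (l, 0) _).2 ⟨j, rfl⟩) (hTe _) (hTe _) (hTe _)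
      (hprec _ _ ?_) (hprec _ _ ?_) fun j' hj' => ?_
    · simpa [val] using h1
    · simpa [val] using h2
    · rw [hTshift]
      apply hprec
      have : (1 : ℝ) ≤ j' := by exact_mod_cast hj'
      simp only [val]
      push_cast
      linarith

theorem coe_zpow_natCast {d : ℕ} (f : Torus d ≃ₜ Torus d) (k : ℕ) :
    ⇑(f ^ (k : ℤ)) = f^[k] := by
  rw [zpow_natCast]
  induction k with
  | zero => rfl
  | succ k ih => rw [pow_succ, Function.iterate_succ, ← ih]; rfl

theorem exists_wandering_circloid (hF : IsAnnularLift L f F) (hρ : Irrational ρ)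
    (hH : Annulus.IsEquivariantHeight F ρ H) :
    ∃ C : Set (Torus (n + 1)), Torus.IsEssentialCircloid C ∧ IsWandering f C ∧
      HasIrrationalCombinatorics (fun k : ℤ => ⇑(f ^ k) '' C) := by
  obtain ⟨C, hCsub, hC⟩ :=
    (hH.isEssentialAnnularContinuum_level 0).exists_isEssentialCircloid_subset
  have hcont := (isOpenQuotientMap_cover (n := n) L).continuous
  have hcomb := hasIrrationalCombinatorics_image_cover hF hρ hH hCsub hC.1.1
  refine ⟨cover L '' C, ⟨hC.1.1.1.image hcont, hC.1.1.2.1.image _ hcont.continuousOn, L, C,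
    isLift_image_cover hH hCsub hC.1.1.2.1, hC⟩, fun k hk => ?_, hcomb⟩
  have := hcomb.1 k 0 (by exact_mod_cast (by omega : k ≠ 0))
  simp only [disjoint_iff_inter_eq_empty, coe_zpow_natCast, zpow_zero] at this
  rwa [show ((1 : Torus (n + 1) ≃ₜ Torus (n + 1)) '' (cover L '' C)) = cover L '' C from
    image_id _] at this

end Torus

theorem theoremt (n : ℕ) (f : Torus (n + 1) ≃ₜ Torus (n + 1))
    (hf : ContinuousMap.Homotopic (f : C(Torus (n + 1), Torus (n + 1)))
      (ContinuousMap.id (Torus (n + 1)))) :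
    List.TFAE [
      -- (i) `f` is semiconjugate to an irrational rotation
      ∃ ρ : ℝ, Irrational ρ ∧ ∃ h : Torus (n + 1) → UnitAddCircle, Torus.IsSemiconjugacy f ρ h,
      -- (ii) a wandering essential circloid with irrational combinatorics
      ∃ C : Set (Torus (n + 1)), Torus.IsEssentialCircloid C ∧ Torus.IsWandering f C ∧
        Torus.HasIrrationalCombinatorics (fun k : ℤ => ⇑(f ^ k) '' C),
      -- (iii) a wandering essential continuum with irrational combinatorics
      ∃ E : Set (Torus (n + 1)), Torus.IsEssentialContinuum E ∧ Torus.IsWandering f E ∧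
        Torus.HasIrrationalCombinatorics (fun k : ℤ => ⇑(f ^ k) '' E),
      -- (iv) a semiconjugacy whose fibres are all essential annular continua
      ∃ ρ : ℝ, Irrational ρ ∧ ∃ h : Torus (n + 1) → UnitAddCircle, Torus.IsSemiconjugacy f ρ h ∧
        ∀ ξ : UnitAddCircle, Torus.IsEssentialAnnularContinuum (h ⁻¹' {ξ})] := by
  tfae_have 1 → 2 := by
    rintro ⟨ρ, hρ, h, hh⟩
    obtain ⟨L, F, ρ', H, hF, hρ', hH⟩ :=
      Torus.exists_isEquivariantHeight_of_isSemiconjugacy hf hρ hh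
    exact Torus.exists_wandering_circloid hF hρ' hH
  tfae_have 2 → 3 := by
    rintro ⟨C, ⟨hC, hCc, L, C', hl, hC'⟩, hw, hi⟩
    exact ⟨C, ⟨hC, hCc, L, C', hl, hC'.1.1⟩, hw, hi⟩
  tfae_have 3 → 4 := by
    rintro ⟨E, ⟨hE, hEc, -⟩, -, hi⟩
    obtain ⟨L, F, ρ, H, hF, hρ, hH⟩ :=
      Torus.exists_isEquivariantHeight_of_hasIrrationalCombinatorics hf hE hEc hi
    exact ⟨ρ, hρ, Torus.exists_isSemiconjugacy hF hH⟩
  tfae_have 4 → 1 := by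
    rintro ⟨ρ, hρ, h, hh, -⟩
    exact ⟨ρ, hρ, h, hh⟩
  tfae_finish
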